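/- **Lemma 2.5.** Let $\nu>0$ and $k\in\mathbb R$, and consider on $t>0$, $y\in(-1,1)$ the temperature equation $$\partial_t\theta_k+iky\,\theta_k-\nu(\partial_y^2-k^2)\theta_k=-ik\,g_k^1-\partial_y g_k^2,\qquad \theta_k|_{y=\pm1}=0,\qquad \theta_k|_{t=0}=\theta_k^{\rm in},$$ with complex-valued $\theta_k^{\rm in}\in L^2(-1,1)$ and $g_k^1,g_k^2\in L^2((0,T)\times(-1,1))$ for every $T>0$. Let $\theta_k$ be a weak solution, that is, $\theta_k\in L^2(0,T;H^1_0(-1,1))$ for every $T>0$ and, for almost every $t>0$ and all $\varphi\in H^1_0(-1,1)$, $$\int_{-1}^1\theta_k(t)\varphi\,dy=\int_{-1}^1\theta_k^{\rm in}\varphi\,dy+\int_0^t\!\int_{-1}^1\Big(-ik\,g_k^1\varphi+g_k^2\,\partial_y\varphi-iky\,\theta_k\varphi-\nu\,\partial_y\theta_k\,\partial_y\varphi-\nu k^2\theta_k\varphi\Big)\,dy\,ds .$$ Write $L^p_tL^2_y=L^p((0,\infty);L^2(-1,1))$, the norms being $+\infty$ for functions outside the space, with $0\cdot\infty=0$.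 There exists a constant $C>0$, independent of $\nu$, $k$, $\theta_k^{\rm in}$, $g_k^1$, $g_k^2$ and $\theta_k$, such that the following holds. If $|k|\ge 10\nu$, then $$\|\theta_k\|_{L^\infty_tL^2_y}+(\nu k^2)^{1/6}\|\theta_k\|_{L^2_tL^2_y}\le C\|\theta_k^{\rm in}\|_{L^2_y}+C\Big(\nu^{-1/6}|k|^{2/3}\|g_k^1\|_{L^2_tL^2_y}+\nu^{-1/2}\|g_k^2\|_{L^2_tL^2_y}\Big),$$ and if $|k|\le 10\nu$, then $$\|\theta_k\|_{L^\infty_tL^2_y}+\nu^{1/2}\|\theta_k\|_{L^2_tL^2_y}\le C\|\theta_k^{\rm in}\|_{L^2_y}+C\Big(\nu^{-1/6}|k|^{2/3}\|g_k^1\|_{L^2_tL^2_y}+\nu^{-1/2}\|g_k^2\|_{L^2_tL^2_y}\Big).$$ -/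

import Mathlib

open MeasureTheory Set

namespace CouetteTemperature

noncomputable section

/-- Lebesgue measure on the time half-line `t > 0`. -/
abbrev timeMeasure : Measure ℝ := volume.restrict (Ioi (0 : ℝ))

/-- Lebesgue measure on the cross-section `-1 < y < 1` of the channel. -/
abbrev channelMeasure : Measure ℝ := volume.restrict (Ioo (-1 : ℝ) 1)

/-- The mixed norm of `L^p_t L^2_y` over `t > 0`, `-1 < y < 1`, of a function `f t y`; it is
extended-real valued, so it is `∞` when `f` is not in the space. -/
def mixedNorm (p : ENNReal) (f : ℝ → ℝ → ℂ) : ENNReal :=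
  eLpNorm (fun t => eLpNorm (f t) 2 channelMeasure) p timeMeasure

/-- `f` belongs to `L^2((0,T) × (-1,1))` for every finite `T > 0`. -/
def LocallyL2 (f : ℝ → ℝ → ℂ) : Prop :=
  ∀ T : ℝ, 0 < T →
    MemLp (fun p : ℝ × ℝ => f p.1 p.2) 2 ((volume.restrict (Ioo (0 : ℝ) T)).prod channelMeasure)

/-- `f` belongs to the Sobolev space `H^1_0(-1,1)` and `f'` is its weak derivative: up to a null
set, `f` is the absolutely continuous function with derivative `f' ∈ L^2(-1,1)` vanishing at both
endpoints `y = -1` and `y = 1`. -/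
structure IsH10 (f f' : ℝ → ℂ) : Prop where
  memLp_deriv : MemLp f' 2 channelMeasure
  eq_primitive : ∀ᵐ y ∂channelMeasure, f y = ∫ z in (-1 : ℝ)..y, f' z
  vanish_right : ∫ z in (-1 : ℝ)..1, f' z = 0

/-- `θ` is a weak solution on `t > 0`, `-1 < y < 1` of
`∂_t θ + i k y θ - ν (∂_y^2 - k^2) θ = - i k g₁ - ∂_y g₂`, `θ(t, ±1) = 0`, `θ(0, ·) = θin`,
in the energy class: `θ` and its weak derivative `θy = ∂_y θ` are square integrable locally in
time, `θ(t) ∈ H^1_0(-1,1)` for almost every `t`, and the equation, integrated over `(0, t)`, holds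
when tested against every `φ ∈ H^1_0(-1,1)`. -/
def IsWeakSolution (ν k : ℝ) (g₁ g₂ : ℝ → ℝ → ℂ) (θin : ℝ → ℂ) (θ : ℝ → ℝ → ℂ) : Prop :=
  LocallyL2 θ ∧
  ∃ θy : ℝ → ℝ → ℂ, LocallyL2 θy ∧
    (∀ᵐ t ∂timeMeasure, IsH10 (θ t) (θy t)) ∧
    ∀ᵐ t ∂timeMeasure, ∀ φ φ' : ℝ → ℂ, IsH10 φ φ' →
      ∫ y, θ t y * φ y ∂channelMeasure =
        (∫ y, θin y * φ y ∂channelMeasure) +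
        ∫ s in (0 : ℝ)..t,
          ((∫ y, (-(Complex.I * k * g₁ s y) * φ y + g₂ s y * φ' y) ∂channelMeasure) -
            ∫ y, (Complex.I * k * y * θ s y * φ y
              + ν * (θy s y * φ' y + (k : ℂ) ^ 2 * θ s y * φ y)) ∂channelMeasure)

end

end CouetteTemperature

/-!
The proof is a hypocoercive energy estimate in the time domain. Write `v`, `w` for the solution and
its `y`-derivative at a given time, extended by zero to the line. The plain energy identity only
yields the dissipation `ν ‖w‖²`. When `|k| ≥ 10 ν`, the energy is modified to `⟨S v, v⟩` with the
self-adjoint multiplier `S = 1 + i c (B - B*)` (`twist`), where `B` is a translation by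
`δ = (ν / |k|)^{1/3}` multiplied by a cut-off that makes `B` and `B*` preserve the Dirichlet
condition, and `c = ∓ 1/30` has the sign opposite to that of `k`. Since multiplication by `y` and
translation by `δ` have the commutator `δ`, the transport term `i k y v` contributes
`-|c k| δ Re ⟨B v, v⟩` to half the derivative of the energy
(`IsZeroExtH10.integral_inner_twist_transport`), and `Re ⟨B v, v⟩` is `‖v‖²` up to an error
`O(δ² ‖w‖²)` (`IsZeroExtH10.integral_cutoff_inner_ge`): translating by `δ` costs `δ ‖w‖`, and the
cut-off only matters in boundary layers of width `O(δ)`, where `v` is small by the Dirichlet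
condition. As `ν = |k| δ³`, all errors are absorbed by the viscous dissipation, and what is left is
decay at the rate `|k| δ = (ν k²)^{1/3}` (`IsZeroExtH10.energyRate_le_of_shear`). When
`|k| ≤ 10 ν`, `c = 0` and the Poincaré inequality suffice
(`IsZeroExtH10.energyRate_le_of_viscous`).

Weak solutions are not differentiable in time, so the energy inequality needs an argument
(`energy_le_of_weak`). The weak formulation at time `t`, tested with the multiplier applied to the
solution at time `r`, gives `a(t, r) = I(r) + ∫₀ᵗ p(s, r) ds` for a symmetric form `a` and a
correlation `p` of two square-integrable functions. Then `a(r, r) - a(t, t)` is the integral over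
`(t, r)` of `p(s, r) + p(s, t)`; with `r = t + h`, averaging over `t` and letting `h → 0` gives the
increment of the energy, because translations are continuous in `L²`
(`isCorrelation_integral_inner`) and almost every time is a Lebesgue point of `t ↦ a(t, t)`.
Averaging over the first time step `(0, h)` recovers the initial datum.
-/

namespace CouetteTemperature

open Filter Topology

/-! ### Square-integrable functions on the line -/

lemma integrable_norm_sq {α E : Type*} [MeasurableSpace α] {μ : Measure α} [NormedAddCommGroup E]
    {f : α → E} (hf : MemLp f 2 μ) : Integrable (fun x => ‖f x‖ ^ 2) μ :=
  (memLp_two_iff_integrable_sq_norm hf.1).1 hf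

lemma memLp_inner {α E : Type*} [MeasurableSpace α] {μ : Measure α} [NormedAddCommGroup E]
    [InnerProductSpace ℝ E] {f g : α → E} (hf : MemLp f 2 μ) (hg : MemLp g 2 μ) :
    Integrable (fun x => inner ℝ (f x) (g x)) μ := by
  refine ((integrable_norm_sq hf).add (integrable_norm_sq hg)).mono' (hf.1.inner hg.1) ?_
  filter_upwards with x
  have h1 := abs_real_inner_le_norm (f x) (g x)
  simp only [Real.norm_eq_abs, Pi.add_apply]
  nlinarith [sq_nonneg (‖f x‖ - ‖g x‖), sq_nonneg (‖f x‖), sq_nonneg (‖g x‖)]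

/-- The Cauchy–Schwarz inequality followed by Young's inequality; the weights `a`, `b` are chosen at
each use so that the terms can be absorbed. -/
lemma abs_integral_inner_le {α E : Type*} [MeasurableSpace α] {μ : Measure α}
    [NormedAddCommGroup E] [InnerProductSpace ℝ E] {f g : α → E} (hf : MemLp f 2 μ)
    (hg : MemLp g 2 μ) {a b : ℝ} (ha : 0 ≤ a) (hb : 0 ≤ b) (hab : 1 ≤ 4 * a * b) :
    |∫ x, inner ℝ (f x) (g x) ∂μ| ≤ a * (∫ x, ‖f x‖ ^ 2 ∂μ) + b * ∫ x, ‖g x‖ ^ 2 ∂μ := by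
  rw [← integral_const_mul, ← integral_const_mul, ← integral_add
    ((integrable_norm_sq hf).const_mul a) ((integrable_norm_sq hg).const_mul b), ← Real.norm_eq_abs]
  refine norm_integral_le_of_norm_le
    (((integrable_norm_sq hf).const_mul a).add ((integrable_norm_sq hg).const_mul b)) ?_
  filter_upwards with x
  have h1 := abs_real_inner_le_norm (f x) (g x)
  rw [Real.norm_eq_abs]
  have h2 : ‖f x‖ * ‖g x‖ ≤ a * ‖f x‖ ^ 2 + b * ‖g x‖ ^ 2 := by
    have h3 : (Real.sqrt a * ‖f x‖ - Real.sqrt b * ‖g x‖) ^ 2 ≥ 0 := sq_nonneg _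
    have h4 : 1 ≤ 2 * (Real.sqrt a * Real.sqrt b) := by
      rw [← Real.sqrt_mul ha]
      have : 1 / 2 ≤ Real.sqrt (a * b) := Real.le_sqrt_of_sq_le (by nlinarith)
      linarith
    have h5 : 0 ≤ ‖f x‖ * ‖g x‖ := by positivity
    nlinarith [Real.sq_sqrt ha, Real.sq_sqrt hb]
  exact h1.trans h2

lemma integral_norm_add_sq_le {α E : Type*} [MeasurableSpace α] {μ : Measure α}
    [NormedAddCommGroup E] {f g : α → E} (hf : MemLp f 2 μ) (hg : MemLp g 2 μ) :
    ∫ x, ‖f x + g x‖ ^ 2 ∂μ ≤ 2 * (∫ x, ‖f x‖ ^ 2 ∂μ) + 2 * ∫ x, ‖g x‖ ^ 2 ∂μ := by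
  rw [← integral_const_mul, ← integral_const_mul, ← integral_add
    ((integrable_norm_sq hf).const_mul 2) ((integrable_norm_sq hg).const_mul 2)]
  refine integral_mono (integrable_norm_sq (hf.add hg))
    (((integrable_norm_sq hf).const_mul 2).add ((integrable_norm_sq hg).const_mul 2)) fun x => ?_
  have h := norm_add_le (f x) (g x)
  have h0 := norm_nonneg (f x + g x)
  simp only
  nlinarith [sq_nonneg (‖f x‖ - ‖g x‖)]

lemma integral_norm_sub_sq_le {α E : Type*} [MeasurableSpace α] {μ : Measure α}
    [NormedAddCommGroup E] {f g : α → E} (hf : MemLp f 2 μ) (hg : MemLp g 2 μ) :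
    ∫ x, ‖f x - g x‖ ^ 2 ∂μ ≤ 2 * (∫ x, ‖f x‖ ^ 2 ∂μ) + 2 * ∫ x, ‖g x‖ ^ 2 ∂μ := by
  have h := integral_norm_add_sq_le hf hg.neg
  simpa [sub_eq_add_neg] using h

lemma integral_norm_sq_le_of_le_mul {α E F : Type*} [MeasurableSpace α] {μ : Measure α}
    [NormedAddCommGroup E] [NormedAddCommGroup F] {f : α → E} {g : α → F} {M : ℝ}
    (hf : MemLp f 2 μ) (h : ∀ x, ‖g x‖ ≤ M * ‖f x‖) :
    ∫ x, ‖g x‖ ^ 2 ∂μ ≤ M ^ 2 * ∫ x, ‖f x‖ ^ 2 ∂μ := by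
  rw [← integral_const_mul]
  refine integral_mono_of_nonneg (Eventually.of_forall fun x => by positivity)
    ((integrable_norm_sq hf).const_mul _) (Eventually.of_forall fun x => ?_)
  simp only
  rw [← mul_pow]
  exact pow_le_pow_left₀ (norm_nonneg _) (h x) 2

lemma integral_norm_sq_nonneg {α E : Type*} [MeasurableSpace α] (μ : Measure α)
    [NormedAddCommGroup E] (f : α → E) : 0 ≤ ∫ x, ‖f x‖ ^ 2 ∂μ :=
  integral_nonneg fun _ => by positivity

lemma memLp_comp_add {f : ℝ → ℂ} (hf : MemLp f 2 volume) (h : ℝ) :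
    MemLp (fun y => f (y + h)) 2 volume :=
  hf.comp_measurePreserving (measurePreserving_add_right volume h)

lemma memLp_comp_sub {f : ℝ → ℂ} (hf : MemLp f 2 volume) (h : ℝ) :
    MemLp (fun y => f (y - h)) 2 volume := by
  simpa [sub_eq_add_neg] using memLp_comp_add hf (-h)

lemma ae_comp_add {p : ℝ → Prop} (hp : ∀ᵐ y : ℝ, p y) (h : ℝ) : ∀ᵐ y : ℝ, p (y + h) :=
  (measurePreserving_add_right volume h).quasiMeasurePreserving.ae hp

/-! ### Absolutely continuous functions vanishing outside the channel -/

lemma intervalIntegrable_of_locallyIntegrable {E : Type*} [NormedAddCommGroup E] {g : ℝ → E}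
    (hg : LocallyIntegrable g volume) (a b : ℝ) : IntervalIntegrable g volume a b :=
  intervalIntegrable_iff.2
    ((hg.integrableOn_isCompact isCompact_uIcc).mono_set uIoc_subset_uIcc)

lemma absolutelyContinuousOnInterval_primitive {g : ℝ → ℂ} (hg : LocallyIntegrable g volume)
    (a b c : ℝ) (hc : c ∈ uIcc a b) :
    AbsolutelyContinuousOnInterval (fun x => ∫ z in c..x, g z) a b := by
  have hi : ∀ x y : ℝ, IntervalIntegrable g volume x y := intervalIntegrable_of_locallyIntegrable hg
  have hre : IntervalIntegrable (fun z => (g z).re) volume a b := ⟨(hi a b).1.re, (hi a b).2.re⟩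
  have him : IntervalIntegrable (fun z => (g z).im) volume a b := ⟨(hi a b).1.im, (hi a b).2.im⟩
  have h1 := hre.absolutelyContinuousOnInterval_intervalIntegral hc
  have h2 := him.absolutelyContinuousOnInterval_intervalIntegral hc
  have hconst : ∀ z : ℂ, AbsolutelyContinuousOnInterval (fun _ : ℝ => z) a b := fun z =>
    (LipschitzWith.const z).lipschitzOnWith.absolutelyContinuousOnInterval
  have h3 := (h1.smul (hconst 1)).add (h2.smul (hconst Complex.I))
  refine (congrArg (fun f => AbsolutelyContinuousOnInterval f a b) (funext fun x => ?_)).mpr h3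
  simp only [Pi.add_apply, Pi.smul_apply', Complex.real_smul, mul_one]
  have e1 : ((∫ z in c..x, (g z).re : ℝ) : ℂ).re = (∫ z in c..x, g z).re :=
    Complex.reCLM.intervalIntegral_comp_comm (hi c x)
  have e2 : ((∫ z in c..x, (g z).im : ℝ) : ℂ).re = (∫ z in c..x, g z).im :=
    Complex.imCLM.intervalIntegral_comp_comm (hi c x)
  rw [Complex.ofReal_re] at e1 e2
  rw [e1, e2, Complex.re_add_im]

/-- The product of a Lipschitz function and a translated primitive is the primitive of the
expression that the Leibniz rule predicts. -/
lemma integral_leibniz {χ : ℝ → ℝ} {K : NNReal} (hχ : LipschitzWith K χ) {g : ℝ → ℂ}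
    (hg : LocallyIntegrable g volume) (h x₀ : ℝ) {F : ℝ → ℂ}
    (hF : ∀ y, F y = ∫ z in x₀..y, g z) (a b : ℝ) :
    ∫ z in a..b, (((deriv χ z : ℝ) : ℂ) * F (z + h) + χ z * g (z + h)) =
      χ b * F (b + h) - χ a * F (a + h) := by
  have hgh : LocallyIntegrable (fun z => g (z + h)) volume := by
    rw [locallyIntegrable_iff]
    intro s hs
    have h1 := (locallyIntegrable_iff.1 hg) ((fun z => z + h) '' s)
      (hs.image (continuous_add_const h))
    have h2 := (measurePreserving_add_right volume h).integrableOn_comp_preimage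
      (MeasurableEquiv.addRight h).measurableEmbedding (f := g) (s := (fun z => z + h) '' s)
    rw [preimage_image_eq _ (add_left_injective h)] at h2
    exact h2.2 h1
  have hi : ∀ x y : ℝ, IntervalIntegrable g volume x y := intervalIntegrable_of_locallyIntegrable hg
  have hFc : Continuous F := by
    have : F = fun y => ∫ z in x₀..y, g z := funext hF
    rw [this]
    exact intervalIntegral.continuous_primitive hi x₀
  have hFh : ∀ y, F (y + h) = F (a + h) + ∫ z in a..y, g (z + h) := by
    intro y
    rw [intervalIntegral.integral_comp_add_right (fun z => g z) h, hF, hF,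
      intervalIntegral.integral_add_adjacent_intervals (hi _ _) (hi _ _)]
  set G : ℝ → ℂ := fun z => ((deriv χ z : ℝ) : ℂ) * F (z + h) + χ z * g (z + h) with hGdef
  have hG : LocallyIntegrable G volume := by
    apply LocallyIntegrable.add
    · have hFl : LocallyIntegrable (fun z => F (z + h)) volume :=
        (hFc.comp (continuous_add_const h)).locallyIntegrable
      rw [locallyIntegrable_iff] at hFl ⊢
      intro s hs
      refine (hFl s hs).bdd_mul (c := K) ?_ ?_
      · exact (Complex.measurable_ofReal.comp (measurable_deriv χ)).aestronglyMeasurable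
      · filter_upwards with z
        rw [Complex.norm_real]
        exact norm_deriv_le_of_lipschitz hχ
    · rw [locallyIntegrable_iff] at hgh ⊢
      intro s hs
      obtain ⟨M, hM⟩ := hs.exists_bound_of_continuousOn hχ.continuous.continuousOn
      refine (hgh s hs).bdd_mul (c := M) ?_ ?_
      · exact (Complex.continuous_ofReal.comp hχ.continuous).aestronglyMeasurable
      · filter_upwards [ae_restrict_mem hs.measurableSet] with z hz
        rw [Complex.norm_real]
        exact hM z hz
  have hac : AbsolutelyContinuousOnInterval
      (fun y => χ y • F (y + h) - ∫ z in a..y, G z) a b := by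
    have h1 := (absolutelyContinuousOnInterval_primitive hgh a b a left_mem_uIcc)
    have h2 : AbsolutelyContinuousOnInterval (fun _ : ℝ => F (a + h)) a b :=
      (LipschitzWith.const _).lipschitzOnWith.absolutelyContinuousOnInterval
    have h3 : AbsolutelyContinuousOnInterval (fun y => F (y + h)) a b :=
      (congrArg (fun f => AbsolutelyContinuousOnInterval f a b) (funext hFh)).mpr (h2.add h1)
    have h4 : AbsolutelyContinuousOnInterval χ a b :=
      LipschitzOnWith.absolutelyContinuousOnInterval (hχ.lipschitzOnWith (s := uIcc a b))
    have h5 : AbsolutelyContinuousOnInterval (χ • fun y => F (y + h)) a b :=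
      AbsolutelyContinuousOnInterval.smul h4 h3
    exact h5.sub (absolutelyContinuousOnInterval_primitive hG a b a left_mem_uIcc)
  obtain ⟨C, hC⟩ := hac.const_of_ae_hasDerivAt_zero (by
    filter_upwards [_root_.LocallyIntegrable.ae_hasDerivAt_integral hG,
      _root_.LocallyIntegrable.ae_hasDerivAt_integral hgh,
      hχ.ae_differentiableAt_real] with x h1 h2 h3 _
    have h4 : HasDerivAt (fun y => F (y + h)) (g (x + h)) x := by
      have := (h2 a).const_add (F (a + h))
      refine this.congr_of_eventuallyEq (Eventually.of_forall hFh)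
    have h5 := (h3.hasDerivAt.smul h4).sub (h1 a)
    have h6 : χ x • g (x + h) + deriv χ x • F (x + h) - G x = 0 := by
      simp only [hGdef, Complex.real_smul]
      ring
    rw [h6] at h5
    exact h5)
  have ha := hC a left_mem_uIcc
  have hb := hC b right_mem_uIcc
  simp only [intervalIntegral.integral_same, sub_zero, Complex.real_smul] at ha hb
  rw [ha, ← hb]
  ring

/-- `v` is, up to a null set, the absolutely continuous function on the whole line whose
derivative is the square-integrable function `w`, both vanishing outside the channel. -/
structure IsZeroExtH10 (v w : ℝ → ℂ) : Prop where
  memLp_deriv : MemLp w 2 volume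
  deriv_eq_zero : ∀ y, y ∉ Ioo (-1 : ℝ) 1 → w y = 0
  eq_primitive : ∀ᵐ y : ℝ, v y = ∫ z in (-1 : ℝ)..y, w z
  vanish_right : ∫ z in (-1 : ℝ)..1, w z = 0

lemma setIntegral_indicator_channel (f : ℝ → ℂ) {y : ℝ} (hy : y ∈ Icc (-1 : ℝ) 1) :
    ∫ z in (-1 : ℝ)..y, (Ioo (-1 : ℝ) 1).indicator f z = ∫ z in (-1 : ℝ)..y, f z := by
  refine intervalIntegral.integral_congr_ae ?_
  have h1 : ∀ᵐ z : ℝ, z ≠ 1 := by simp [ae_iff, measure_singleton]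
  filter_upwards [h1] with z hz hz2
  rw [uIoc_of_le hy.1] at hz2
  rw [indicator_of_mem]
  exact ⟨hz2.1, lt_of_le_of_ne (hz2.2.trans hy.2) hz⟩

lemma IsZeroExtH10.locallyIntegrable {v w : ℝ → ℂ} (h : IsZeroExtH10 v w) :
    LocallyIntegrable w volume :=
  h.memLp_deriv.locallyIntegrable (by norm_num)

lemma IsZeroExtH10.primitive_eq_zero {v w : ℝ → ℂ} (h : IsZeroExtH10 v w) {y : ℝ}
    (hy : y ∉ Ioo (-1 : ℝ) 1) : ∫ z in (-1 : ℝ)..y, w z = 0 := by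
  by_cases h1 : y ≤ -1
  · rw [intervalIntegral.integral_congr (g := fun _ => (0 : ℂ)), intervalIntegral.integral_zero]
    intro z hz
    rw [uIcc_of_ge h1] at hz
    exact h.deriv_eq_zero z fun hh => absurd hh.1 (not_lt.2 hz.2)
  · have h2 : 1 ≤ y := by
      by_contra h3
      exact hy ⟨not_le.1 h1, not_le.1 h3⟩
    rw [← intervalIntegral.integral_add_adjacent_intervals
      (intervalIntegrable_of_locallyIntegrable h.locallyIntegrable _ _)
      (intervalIntegrable_of_locallyIntegrable h.locallyIntegrable _ _), h.vanish_right, zero_add,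
      intervalIntegral.integral_congr (g := fun _ => (0 : ℂ)), intervalIntegral.integral_zero]
    intro z hz
    rw [uIcc_of_le h2] at hz
    exact h.deriv_eq_zero z fun hh => absurd hh.2 (not_lt.2 hz.1)

lemma IsZeroExtH10.continuous_primitive {v w : ℝ → ℂ} (h : IsZeroExtH10 v w) :
    Continuous fun y => ∫ z in (-1 : ℝ)..y, w z :=
  intervalIntegral.continuous_primitive
    (intervalIntegrable_of_locallyIntegrable h.locallyIntegrable) _

lemma IsZeroExtH10.memLp {v w : ℝ → ℂ} (h : IsZeroExtH10 v w) : MemLp v 2 volume := by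
  have h1 : MemLp (fun y => ∫ z in (-1 : ℝ)..y, w z) 2 volume := by
    refine h.continuous_primitive.memLp_of_hasCompactSupport ?_
    refine HasCompactSupport.intro (isCompact_Icc (a := (-1 : ℝ)) (b := 1)) fun y hy => ?_
    exact h.primitive_eq_zero fun hh => hy (Ioo_subset_Icc_self hh)
  exact h1.ae_eq (h.eq_primitive.mono fun _ hy => hy.symm)

lemma IsZeroExtH10.ae_eq_zero {v w : ℝ → ℂ} (h : IsZeroExtH10 v w) :
    ∀ᵐ y : ℝ, y ∉ Ioo (-1 : ℝ) 1 → v y = 0 := by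
  filter_upwards [h.eq_primitive] with y hy hy2
  rw [hy, h.primitive_eq_zero hy2]

lemma IsH10.isZeroExtH10 {f f' : ℝ → ℂ} (h : IsH10 f f') :
    IsZeroExtH10 ((Ioo (-1 : ℝ) 1).indicator f) ((Ioo (-1 : ℝ) 1).indicator f') := by
  have h2 : ∫ z in (-1 : ℝ)..1, (Ioo (-1 : ℝ) 1).indicator f' z = 0 := by
    rw [setIntegral_indicator_channel f' (by simp)]
    exact h.vanish_right
  have key : IsZeroExtH10 (fun y => ∫ z in (-1 : ℝ)..y, (Ioo (-1 : ℝ) 1).indicator f' z)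
      ((Ioo (-1 : ℝ) 1).indicator f') :=
    ⟨(memLp_indicator_iff_restrict measurableSet_Ioo).2 h.memLp_deriv,
      fun y hy => indicator_of_notMem hy _, Eventually.of_forall fun _ => rfl, h2⟩
  refine ⟨key.memLp_deriv, key.deriv_eq_zero, ?_, h2⟩
  have h1 := (ae_restrict_iff' measurableSet_Ioo).1 h.eq_primitive
  filter_upwards [h1] with y hy
  by_cases hm : y ∈ Ioo (-1 : ℝ) 1
  · rw [indicator_of_mem hm, hy hm, setIntegral_indicator_channel f' (Ioo_subset_Icc_self hm)]
  · rw [indicator_of_notMem hm, key.primitive_eq_zero hm]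

/-- The Cauchy–Schwarz inequality on an interval, from the nonnegativity of the variance. -/
lemma norm_integral_sq_le {f : ℝ → ℂ} (hf : MemLp f 2 volume) {h : ℝ} (hh : 0 ≤ h) :
    ‖∫ s in (0 : ℝ)..h, f s‖ ^ 2 ≤ h * ∫ s in (0 : ℝ)..h, ‖f s‖ ^ 2 := by
  have hfi : IntervalIntegrable f volume 0 h :=
    intervalIntegrable_of_locallyIntegrable (hf.locallyIntegrable (by norm_num)) _ _
  have hsq : IntervalIntegrable (fun s => ‖f s‖ ^ 2) volume 0 h :=
    (integrable_norm_sq hf).intervalIntegrable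
  rcases hh.eq_or_lt with rfl | hpos
  · simp
  set A := ∫ s in (0 : ℝ)..h, ‖f s‖ with hA
  have h1 : ‖∫ s in (0 : ℝ)..h, f s‖ ≤ A := intervalIntegral.norm_integral_le_integral_norm hh
  have h2 : 0 ≤ ∫ s in (0 : ℝ)..h, (‖f s‖ - A / h) ^ 2 :=
    intervalIntegral.integral_nonneg hh fun _ _ => sq_nonneg _
  have h3 : ∫ s in (0 : ℝ)..h, (‖f s‖ - A / h) ^ 2
      = (∫ s in (0 : ℝ)..h, ‖f s‖ ^ 2) - A ^ 2 / h := by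
    have : ∀ s, (‖f s‖ - A / h) ^ 2 = ‖f s‖ ^ 2 - (2 * (A / h)) * ‖f s‖ + (A / h) ^ 2 :=
      fun s => by ring
    simp_rw [this]
    rw [intervalIntegral.integral_add (hsq.sub (hfi.norm.const_mul _)) (by simp),
      intervalIntegral.integral_sub hsq (hfi.norm.const_mul _),
      intervalIntegral.integral_const_mul, ← hA, intervalIntegral.integral_const]
    simp only [sub_zero, smul_eq_mul]
    field_simp
    ring
  rw [h3] at h2
  have h4 : A ^ 2 / h ≤ ∫ s in (0 : ℝ)..h, ‖f s‖ ^ 2 := by linarith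
  rw [div_le_iff₀ hpos] at h4
  have h5 : ‖∫ s in (0 : ℝ)..h, f s‖ ^ 2 ≤ A ^ 2 := pow_le_pow_left₀ (norm_nonneg _) h1 2
  linarith

/-- Translating a function by `h` changes it in `L²` by at most `h` times the norm of the
derivative. For `h` the width of a boundary layer, or of the channel, this is also the Poincaré
inequality there, because one of the two values is then zero. -/
lemma IsZeroExtH10.integral_norm_translate_sub_sq_le {v w : ℝ → ℂ} (hv : IsZeroExtH10 v w) {h : ℝ}
    (hh : 0 ≤ h) : ∫ y, ‖v (y + h) - v y‖ ^ 2 ≤ h ^ 2 * ∫ y, ‖w y‖ ^ 2 := by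
  have hint : Integrable (fun z : ℝ × ℝ => ‖w (z.1 + z.2)‖ ^ 2)
      (volume.prod (volume.restrict (Ioc 0 h))) := by
    have h1 : Integrable (fun z : ℝ × ℝ => ‖w z.1‖ ^ 2)
        (volume.prod (volume.restrict (Ioc 0 h))) :=
      (integrable_norm_sq hv.memLp_deriv).comp_fst _
    have h2 := (measurePreserving_sub_prod volume (volume.restrict (Ioc 0 h)) :
      MeasurePreserving (fun z : ℝ × ℝ => (z.1 - z.2, z.2)) _ _)
    have h3 : MeasurePreserving (fun z : ℝ × ℝ => (z.1 + z.2, z.2))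
      (volume.prod (volume.restrict (Ioc 0 h))) (volume.prod (volume.restrict (Ioc 0 h))) :=
      measurePreserving_add_prod volume (volume.restrict (Ioc 0 h))
    exact h3.integrable_comp_of_integrable h1
  have hpt : ∀ᵐ y : ℝ, ‖v (y + h) - v y‖ ^ 2 ≤ h * ∫ s in Ioc 0 h, ‖w (y + s)‖ ^ 2 := by
    filter_upwards [hv.eq_primitive, ae_comp_add hv.eq_primitive h] with y h1 h2
    have h3 : v (y + h) - v y = ∫ s in (0 : ℝ)..h, w (y + s) := by
      rw [h1, h2, intervalIntegral.integral_interval_sub_left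
        (intervalIntegrable_of_locallyIntegrable hv.locallyIntegrable _ _)
        (intervalIntegrable_of_locallyIntegrable hv.locallyIntegrable _ _),
        intervalIntegral.integral_comp_add_left (fun s => w s) y, add_zero]
    rw [h3, ← intervalIntegral.integral_of_le hh]
    refine norm_integral_sq_le ?_ hh
    simpa [add_comm] using memLp_comp_add hv.memLp_deriv y
  calc ∫ y, ‖v (y + h) - v y‖ ^ 2 ≤ ∫ y, h * ∫ s in Ioc 0 h, ‖w (y + s)‖ ^ 2 :=
        integral_mono_of_nonneg (Eventually.of_forall fun _ => by positivity)
          (hint.integral_prod_left.const_mul h) hpt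
    _ = h * ∫ s in Ioc 0 h, ∫ y, ‖w (y + s)‖ ^ 2 := by
        rw [integral_const_mul, integral_integral_swap hint]
    _ = h ^ 2 * ∫ y, ‖w y‖ ^ 2 := by
        simp_rw [fun s => integral_add_right_eq_self (μ := volume) (fun y => ‖w y‖ ^ 2) s]
        rw [setIntegral_const]
        simp [hh]
        ring

lemma IsZeroExtH10.poincare {v w : ℝ → ℂ} (hv : IsZeroExtH10 v w) :
    ∫ y, ‖v y‖ ^ 2 ≤ 4 * ∫ y, ‖w y‖ ^ 2 := by
  have h := hv.integral_norm_translate_sub_sq_le (h := 2) (by norm_num)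
  have h0 : ∫ y, ‖v y‖ ^ 2 ≤ ∫ y, ‖v (y + 2) - v y‖ ^ 2 := by
    refine integral_mono_ae (integrable_norm_sq hv.memLp)
      (integrable_norm_sq ((memLp_comp_add hv.memLp 2).sub hv.memLp)) ?_
    filter_upwards [hv.ae_eq_zero, ae_comp_add hv.ae_eq_zero 2] with y h1 h2
    by_cases hy : y ∈ Ioo (-1 : ℝ) 1
    · rw [h2 fun hh => by linarith [hh.2, hy.1]]
      simp
    · rw [h1 hy]
      simp
  linarith

noncomputable section

/-! ### The cut-off shift -/

/-- The trapezoidal cut-off of the channel: it vanishes for `y ≤ -1` and for `y ≥ 1 - δ`, equals `1`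
on `[-1 + δ, 1 - 2 δ]`, and has slopes `± 1 / δ` in between. -/
def cutoff (δ y : ℝ) : ℝ := max 0 (min 1 (min ((1 + y) / δ) ((1 - δ - y) / δ)))

lemma cutoff_nonneg (δ y : ℝ) : 0 ≤ cutoff δ y := le_max_left _ _

lemma cutoff_le_one (δ y : ℝ) : cutoff δ y ≤ 1 := max_le zero_le_one (min_le_left _ _)

lemma cutoff_eq_zero_of_le {δ y : ℝ} (hδ : 0 < δ) (hy : y ≤ -1) : cutoff δ y = 0 :=
  max_eq_left ((min_le_right _ _).trans ((min_le_left _ _).trans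
    (div_nonpos_of_nonpos_of_nonneg (by linarith) hδ.le)))

lemma cutoff_eq_zero_of_ge {δ y : ℝ} (hδ : 0 < δ) (hy : 1 - δ ≤ y) : cutoff δ y = 0 :=
  max_eq_left ((min_le_right _ _).trans ((min_le_right _ _).trans
    (div_nonpos_of_nonpos_of_nonneg (by linarith) hδ.le)))

lemma cutoff_eq_one {δ y : ℝ} (hδ : 0 < δ) (h1 : -1 + δ ≤ y) (h2 : y ≤ 1 - 2 * δ) :
    cutoff δ y = 1 := by
  have h3 : 1 ≤ (1 + y) / δ := (one_le_div hδ).2 (by linarith)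
  have h4 : 1 ≤ (1 - δ - y) / δ := (one_le_div hδ).2 (by linarith)
  rw [cutoff, min_eq_left (le_min h3 h4), max_eq_right zero_le_one]

lemma lipschitzWith_cutoff {δ : ℝ} (hδ : 0 < δ) : LipschitzWith (Real.toNNReal δ⁻¹) (cutoff δ) := by
  have h1 : LipschitzWith (Real.toNNReal δ⁻¹) fun y : ℝ => (1 + y) / δ := by
    refine LipschitzWith.of_dist_le_mul fun x y => ?_
    rw [Real.coe_toNNReal _ (by positivity), Real.dist_eq, Real.dist_eq, ← sub_div, abs_div,
      abs_of_pos hδ, div_eq_inv_mul]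
    ring_nf
    exact le_rfl
  have h2 : LipschitzWith (Real.toNNReal δ⁻¹) fun y : ℝ => (1 - δ - y) / δ := by
    refine LipschitzWith.of_dist_le_mul fun x y => ?_
    rw [Real.coe_toNNReal _ (by positivity), Real.dist_eq, Real.dist_eq, ← sub_div, abs_div,
      abs_of_pos hδ, div_eq_inv_mul, abs_sub_comm x y]
    ring_nf
    exact le_rfl
  have h3 := ((h1.min h2).const_min 1).const_max 0
  rwa [max_self] at h3

lemma continuous_cutoff {δ : ℝ} (hδ : 0 < δ) : Continuous (cutoff δ) :=
  (lipschitzWith_cutoff hδ).continuous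

lemma abs_deriv_cutoff_le {δ : ℝ} (hδ : 0 < δ) (y : ℝ) : |deriv (cutoff δ) y| ≤ δ⁻¹ := by
  have h := norm_deriv_le_of_lipschitz (x₀ := y) (lipschitzWith_cutoff hδ)
  rwa [Real.coe_toNNReal _ (by positivity), Real.norm_eq_abs] at h

/-- The difference `B - B*` of the cut-off shift `(B v)(y) = χ(y) v(y + δ)` and its adjoint
`(B* v)(y) = χ(y - δ) v(y - δ)`, where `χ` is `cutoff δ`. Both map functions that vanish at the
walls to such functions. -/
def skew (δ : ℝ) (v : ℝ → ℂ) (y : ℝ) : ℂ :=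
  cutoff δ y * v (y + δ) - cutoff δ (y - δ) * v (y - δ)

/-- The weak derivative of `skew δ v` when `w` is that of `v`. -/
def skewDeriv (δ : ℝ) (v w : ℝ → ℂ) (y : ℝ) : ℂ :=
  (((deriv (cutoff δ) y : ℝ) : ℂ) * v (y + δ) + cutoff δ y * w (y + δ)) -
    (((deriv (cutoff δ) (y - δ) : ℝ) : ℂ) * v (y - δ) + cutoff δ (y - δ) * w (y - δ))

/-- The bounded self-adjoint multiplier `1 + i c (B - B*)` of the energy method. -/
def twist (c δ : ℝ) (v : ℝ → ℂ) (y : ℝ) : ℂ := v y + c * Complex.I * skew δ v y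

/-- The weak derivative of `twist c δ v` when `w` is that of `v`. -/
def twistDeriv (c δ : ℝ) (v w : ℝ → ℂ) (y : ℝ) : ℂ := w y + c * Complex.I * skewDeriv δ v w y

variable {δ : ℝ} {v w : ℝ → ℂ}

lemma norm_cutoff_mul_le (δ y : ℝ) (z : ℂ) : ‖(cutoff δ y : ℂ) * z‖ ≤ 1 * ‖z‖ := by
  rw [norm_mul, Complex.norm_real, Real.norm_eq_abs, abs_of_nonneg (cutoff_nonneg δ y)]
  exact mul_le_mul_of_nonneg_right (cutoff_le_one δ y) (norm_nonneg z)

lemma norm_deriv_cutoff_mul_le (hδ : 0 < δ) (y : ℝ) (z : ℂ) :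
    ‖((deriv (cutoff δ) y : ℝ) : ℂ) * z‖ ≤ δ⁻¹ * ‖z‖ := by
  rw [norm_mul, Complex.norm_real, Real.norm_eq_abs]
  exact mul_le_mul_of_nonneg_right (abs_deriv_cutoff_le hδ y) (norm_nonneg z)

lemma memLp_cutoff_mul (hδ : 0 < δ) (hv : MemLp v 2 volume) :
    MemLp (fun y => (cutoff δ y : ℂ) * v y) 2 volume :=
  hv.of_le_mul (((Complex.continuous_ofReal.comp (continuous_cutoff hδ)).aestronglyMeasurable).mul
    hv.1) (Eventually.of_forall fun y => norm_cutoff_mul_le δ y (v y))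

lemma memLp_deriv_cutoff_mul (hδ : 0 < δ) (hv : MemLp v 2 volume) :
    MemLp (fun y => ((deriv (cutoff δ) y : ℝ) : ℂ) * v y) 2 volume :=
  hv.of_le_mul (((Complex.measurable_ofReal.comp (measurable_deriv _)).aestronglyMeasurable).mul
    hv.1) (Eventually.of_forall fun y => norm_deriv_cutoff_mul_le hδ y (v y))

lemma memLp_up (hδ : 0 < δ) (hv : MemLp v 2 volume) :
    MemLp (fun y => (cutoff δ y : ℂ) * v (y + δ)) 2 volume :=
  memLp_cutoff_mul hδ (memLp_comp_add hv δ)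

lemma memLp_down (hδ : 0 < δ) (hv : MemLp v 2 volume) :
    MemLp (fun y => (cutoff δ (y - δ) : ℂ) * v (y - δ)) 2 volume :=
  memLp_comp_sub (memLp_cutoff_mul hδ hv) δ

lemma memLp_deriv_up (hδ : 0 < δ) (hv : MemLp v 2 volume) :
    MemLp (fun y => ((deriv (cutoff δ) y : ℝ) : ℂ) * v (y + δ)) 2 volume :=
  memLp_deriv_cutoff_mul hδ (memLp_comp_add hv δ)

lemma memLp_deriv_down (hδ : 0 < δ) (hv : MemLp v 2 volume) :
    MemLp (fun y => ((deriv (cutoff δ) (y - δ) : ℝ) : ℂ) * v (y - δ)) 2 volume :=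
  memLp_comp_sub (memLp_deriv_cutoff_mul hδ hv) δ

lemma memLp_skew (hδ : 0 < δ) (hv : MemLp v 2 volume) : MemLp (skew δ v) 2 volume :=
  (memLp_up hδ hv).sub (memLp_down hδ hv)

lemma memLp_skewDeriv (hδ : 0 < δ) (hv : MemLp v 2 volume) (hw : MemLp w 2 volume) :
    MemLp (skewDeriv δ v w) 2 volume :=
  ((memLp_deriv_up hδ hv).add (memLp_up hδ hw)).sub
    ((memLp_deriv_down hδ hv).add (memLp_down hδ hw))

lemma memLp_twist (c : ℝ) (hδ : 0 < δ) (hv : MemLp v 2 volume) : MemLp (twist c δ v) 2 volume :=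
  hv.add ((memLp_skew hδ hv).const_mul _)

lemma memLp_twistDeriv (c : ℝ) (hδ : 0 < δ) (hv : MemLp v 2 volume) (hw : MemLp w 2 volume) :
    MemLp (twistDeriv c δ v w) 2 volume :=
  hw.add ((memLp_skewDeriv hδ hv hw).const_mul _)

lemma integral_norm_up_sq_le (hv : MemLp v 2 volume) :
    ∫ y, ‖(cutoff δ y : ℂ) * v (y + δ)‖ ^ 2 ≤ ∫ y, ‖v y‖ ^ 2 := by
  have h := integral_norm_sq_le_of_le_mul (memLp_comp_add hv δ)
    fun y => norm_cutoff_mul_le δ y (v (y + δ))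
  rwa [one_pow, one_mul, integral_add_right_eq_self (fun y => ‖v y‖ ^ 2) δ] at h

lemma integral_norm_down_sq_le (hv : MemLp v 2 volume) :
    ∫ y, ‖(cutoff δ (y - δ) : ℂ) * v (y - δ)‖ ^ 2 ≤ ∫ y, ‖v y‖ ^ 2 := by
  have h := integral_norm_sq_le_of_le_mul (memLp_comp_sub hv δ)
    fun y => norm_cutoff_mul_le δ (y - δ) (v (y - δ))
  rwa [one_pow, one_mul, integral_sub_right_eq_self (fun y => ‖v y‖ ^ 2) δ] at h

lemma integral_norm_deriv_up_sq_le (hδ : 0 < δ) (hv : MemLp v 2 volume) :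
    ∫ y, ‖((deriv (cutoff δ) y : ℝ) : ℂ) * v (y + δ)‖ ^ 2 ≤ δ⁻¹ ^ 2 * ∫ y, ‖v y‖ ^ 2 := by
  have h := integral_norm_sq_le_of_le_mul (memLp_comp_add hv δ)
    fun y => norm_deriv_cutoff_mul_le hδ y (v (y + δ))
  rwa [integral_add_right_eq_self (fun y => ‖v y‖ ^ 2) δ] at h

lemma integral_norm_deriv_down_sq_le (hδ : 0 < δ) (hv : MemLp v 2 volume) :
    ∫ y, ‖((deriv (cutoff δ) (y - δ) : ℝ) : ℂ) * v (y - δ)‖ ^ 2 ≤ δ⁻¹ ^ 2 * ∫ y, ‖v y‖ ^ 2 := by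
  have h := integral_norm_sq_le_of_le_mul (memLp_comp_sub hv δ)
    fun y => norm_deriv_cutoff_mul_le hδ (y - δ) (v (y - δ))
  rwa [integral_sub_right_eq_self (fun y => ‖v y‖ ^ 2) δ] at h

lemma integral_norm_skew_sq_le (hδ : 0 < δ) (hv : MemLp v 2 volume) :
    ∫ y, ‖skew δ v y‖ ^ 2 ≤ 4 * ∫ y, ‖v y‖ ^ 2 := by
  have h := integral_norm_sub_sq_le (memLp_up hδ hv) (memLp_down hδ hv)
  have h1 := integral_norm_up_sq_le (δ := δ) hv
  have h2 := integral_norm_down_sq_le (δ := δ) hv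
  simp only [skew]
  linarith

lemma integral_norm_skewDeriv_sq_le (hδ : 0 < δ) (hv : MemLp v 2 volume) (hw : MemLp w 2 volume) :
    ∫ y, ‖skewDeriv δ v w y‖ ^ 2 ≤ 8 * (δ⁻¹ ^ 2 * ∫ y, ‖v y‖ ^ 2) + 8 * ∫ y, ‖w y‖ ^ 2 := by
  have h := integral_norm_sub_sq_le ((memLp_deriv_up hδ hv).add (memLp_up hδ hw))
    ((memLp_deriv_down hδ hv).add (memLp_down hδ hw))
  have h1 := integral_norm_add_sq_le (memLp_deriv_up hδ hv) (memLp_up hδ hw)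
  have h2 := integral_norm_add_sq_le (memLp_deriv_down hδ hv) (memLp_down hδ hw)
  have h3 := integral_norm_up_sq_le (δ := δ) hw
  have h4 := integral_norm_down_sq_le (δ := δ) hw
  have h5 := integral_norm_deriv_up_sq_le hδ hv
  have h6 := integral_norm_deriv_down_sq_le hδ hv
  simp only [skewDeriv]
  simp only [Pi.add_apply] at h
  linarith

lemma integral_norm_const_I_mul_sq (c : ℝ) (f : ℝ → ℂ) :
    ∫ y, ‖(c : ℂ) * Complex.I * f y‖ ^ 2 = c ^ 2 * ∫ y, ‖f y‖ ^ 2 := by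
  rw [← integral_const_mul]
  congr 1
  ext y
  simp [mul_pow]

lemma integral_norm_twist_sq_le {c : ℝ} (hc : |c| ≤ 1 / 30) (hδ : 0 < δ) (hv : MemLp v 2 volume) :
    ∫ y, ‖twist c δ v y‖ ^ 2 ≤ 3 * ∫ y, ‖v y‖ ^ 2 := by
  have h := integral_norm_add_sq_le hv ((memLp_skew hδ hv).const_mul (c * Complex.I))
  rw [integral_norm_const_I_mul_sq] at h
  have h1 := integral_norm_skew_sq_le hδ hv
  have h2 : c ^ 2 ≤ (1 / 30) ^ 2 := sq_le_sq' (by linarith [abs_le.1 hc]) (abs_le.1 hc).2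
  have h3 := integral_norm_sq_nonneg volume v
  have h4 := integral_norm_sq_nonneg volume (skew δ v)
  simp only [twist]
  nlinarith

lemma integral_norm_twistDeriv_sq_le {c : ℝ} (hc : |c| ≤ 1 / 30) (hδ : 0 < δ)
    (hv : MemLp v 2 volume) (hw : MemLp w 2 volume) :
    ∫ y, ‖twistDeriv c δ v w y‖ ^ 2 ≤
      3 * (∫ y, ‖w y‖ ^ 2) + 1 / 50 * (δ⁻¹ ^ 2 * ∫ y, ‖v y‖ ^ 2) := by
  have h := integral_norm_add_sq_le hw ((memLp_skewDeriv hδ hv hw).const_mul (c * Complex.I))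
  rw [integral_norm_const_I_mul_sq] at h
  have h1 := integral_norm_skewDeriv_sq_le hδ hv hw
  have h2 : c ^ 2 ≤ (1 / 30) ^ 2 := sq_le_sq' (by linarith [abs_le.1 hc]) (abs_le.1 hc).2
  have h3 := integral_norm_sq_nonneg volume w
  have h4 := integral_norm_sq_nonneg volume (skewDeriv δ v w)
  have h5 : 0 ≤ δ⁻¹ ^ 2 * ∫ y, ‖v y‖ ^ 2 :=
    mul_nonneg (by positivity) (integral_norm_sq_nonneg volume v)
  simp only [twistDeriv]
  nlinarith

lemma inner_real_mul (r : ℝ) (a b : ℂ) : inner ℝ ((r : ℂ) * a) b = r * inner ℝ a b := by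
  simp only [Complex.inner, Complex.mul_re, Complex.mul_im, Complex.ofReal_re, Complex.ofReal_im,
    Complex.conj_re, Complex.conj_im]
  ring

lemma inner_mul_real (r : ℝ) (a b : ℂ) : inner ℝ a ((r : ℂ) * b) = r * inner ℝ a b := by
  rw [real_inner_comm, inner_real_mul, real_inner_comm]

lemma inner_I_mul (a b : ℂ) : inner ℝ (Complex.I * a) b = inner ℝ a (-(Complex.I * b)) := by
  simp only [Complex.inner, Complex.mul_re, Complex.mul_im, Complex.neg_re, Complex.neg_im,
    Complex.conj_re, Complex.conj_im, Complex.I_re, Complex.I_im]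
  ring

lemma inner_I_mul_I_mul (a b : ℂ) :
    inner ℝ (Complex.I * a) (Complex.I * b) = inner ℝ a b := by
  rw [inner_I_mul, ← mul_assoc, Complex.I_mul_I]
  simp

lemma integral_inner_skew (hδ : 0 < δ) {u : ℝ → ℂ} (hv : MemLp v 2 volume) (hu : MemLp u 2 volume) :
    ∫ y, inner ℝ (skew δ v y) (u y) =
      ∫ y, cutoff δ y * (inner ℝ (v (y + δ)) (u y) - inner ℝ (v y) (u (y + δ))) := by
  have h1 := memLp_inner (memLp_up hδ hv) hu
  have h2 := memLp_inner (memLp_down hδ hv) hu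
  have h3 : ∫ y, inner ℝ ((cutoff δ (y - δ) : ℂ) * v (y - δ)) (u y) =
      ∫ y, inner ℝ ((cutoff δ y : ℂ) * v y) (u (y + δ)) := by
    rw [← integral_add_right_eq_self
      (fun y => (inner ℝ ((cutoff δ (y - δ) : ℂ) * v (y - δ)) (u y) : ℝ)) δ]
    simp only [add_sub_cancel_right]
  have h4 := memLp_inner (memLp_cutoff_mul hδ hv) (memLp_comp_add hu δ)
  simp only [skew, inner_sub_left]
  rw [integral_sub h1 h2, h3, ← integral_sub h1 h4]
  congr 1
  ext y
  rw [inner_real_mul, inner_real_mul]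
  ring

lemma integral_inner_twist (c : ℝ) (hδ : 0 < δ) {u : ℝ → ℂ} (hv : MemLp v 2 volume)
    (hu : MemLp u 2 volume) :
    ∫ y, inner ℝ (twist c δ v y) (u y) =
      (∫ y, inner ℝ (v y) (u y)) + c * ∫ y, inner ℝ (Complex.I * skew δ v y) (u y) := by
  rw [← integral_const_mul, ← integral_add (memLp_inner hv hu)
    ((memLp_inner ((memLp_skew hδ hv).const_mul Complex.I) hu).const_mul c)]
  congr 1
  ext y
  rw [twist, inner_add_left, mul_assoc, inner_real_mul]

lemma integral_inner_twistDeriv (c : ℝ) (hδ : 0 < δ) {u : ℝ → ℂ} (hv : MemLp v 2 volume)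
    (hw : MemLp w 2 volume) (hu : MemLp u 2 volume) :
    ∫ y, inner ℝ (twistDeriv c δ v w y) (u y) =
      (∫ y, inner ℝ (w y) (u y)) + c * ∫ y, inner ℝ (Complex.I * skewDeriv δ v w y) (u y) := by
  rw [← integral_const_mul, ← integral_add (memLp_inner hw hu)
    ((memLp_inner ((memLp_skewDeriv hδ hv hw).const_mul Complex.I) hu).const_mul c)]
  congr 1
  ext y
  rw [twistDeriv, inner_add_left, mul_assoc, inner_real_mul]

/-- The multiplier is self-adjoint. -/
lemma integral_inner_twist_comm (c : ℝ) (hδ : 0 < δ) {v₁ v₂ : ℝ → ℂ} (h₁ : MemLp v₁ 2 volume)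
    (h₂ : MemLp v₂ 2 volume) :
    ∫ y, inner ℝ (twist c δ v₁ y) (v₂ y) = ∫ y, inner ℝ (twist c δ v₂ y) (v₁ y) := by
  rw [integral_inner_twist c hδ h₁ h₂, integral_inner_twist c hδ h₂ h₁]
  simp only [inner_I_mul]
  rw [integral_inner_skew hδ h₁ (u := fun y => -(Complex.I * v₂ y)) (h₂.const_mul _).neg,
    integral_inner_skew hδ h₂ (u := fun y => -(Complex.I * v₁ y)) (h₁.const_mul _).neg]
  congr 2
  · ext y
    exact real_inner_comm _ _
  · congr 1
    ext y
    simp only [Complex.inner, Complex.mul_re, Complex.mul_im, Complex.neg_re, Complex.neg_im,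
      Complex.conj_re, Complex.conj_im, Complex.I_re, Complex.I_im]
    ring

lemma abs_integral_inner_I_skew_le (hδ : 0 < δ) (hv : MemLp v 2 volume) :
    |∫ y, inner ℝ (Complex.I * skew δ v y) (v y)| ≤ 5 / 2 * ∫ y, ‖v y‖ ^ 2 := by
  have h := abs_integral_inner_le ((memLp_skew hδ hv).const_mul Complex.I) hv
    (a := 1 / 2) (b := 1 / 2) (by norm_num) (by norm_num) (by norm_num)
  simp only [norm_mul, Complex.norm_I, one_mul] at h
  linarith [integral_norm_skew_sq_le hδ hv]

lemma integral_inner_self_eq (v : ℝ → ℂ) : ∫ y, inner ℝ (v y) (v y) = ∫ y, ‖v y‖ ^ 2 := by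
  simp only [real_inner_self_eq_norm_sq]

/-- The twisted energy is comparable with the energy. -/
lemma half_le_integral_inner_twist {c : ℝ} (hc : |c| ≤ 1 / 30) (hδ : 0 < δ)
    (hv : MemLp v 2 volume) :
    1 / 2 * ∫ y, ‖v y‖ ^ 2 ≤ ∫ y, inner ℝ (twist c δ v y) (v y) := by
  rw [integral_inner_twist c hδ hv hv, integral_inner_self_eq]
  have h := abs_integral_inner_I_skew_le hδ hv
  have h1 := integral_norm_sq_nonneg volume v
  have h2 : |c * ∫ y, inner ℝ (Complex.I * skew δ v y) (v y)| ≤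
      1 / 30 * (5 / 2 * ∫ y, ‖v y‖ ^ 2) := by
    rw [abs_mul]
    exact mul_le_mul hc h (abs_nonneg _) (by norm_num)
  linarith [(abs_le.1 h2).1]

/-! ### The multiplier preserves the boundary condition -/

lemma IsZeroExtH10.integral_twistDeriv (c : ℝ) (hδ : 0 < δ) (hv : IsZeroExtH10 v w) (y : ℝ) :
    ∫ z in (-1 : ℝ)..y, twistDeriv c δ v w z =
      twist c δ (fun y => ∫ z in (-1 : ℝ)..y, w z) y := by
  set F : ℝ → ℂ := fun y => ∫ z in (-1 : ℝ)..y, w z with hF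
  have hFm : MemLp F 2 volume := hv.memLp.ae_eq hv.eq_primitive
  have hw := hv.memLp_deriv
  have hae : ∀ᵐ z : ℝ, twistDeriv c δ v w z = twistDeriv c δ F w z := by
    filter_upwards [ae_comp_add hv.eq_primitive δ, ae_comp_add hv.eq_primitive (-δ)] with z h1 h2
    rw [← sub_eq_add_neg] at h2
    simp only [twistDeriv, skewDeriv, h1, h2, hF]
  rw [intervalIntegral.integral_congr_ae (hae.mono fun z hz _ => hz)]
  have hii : ∀ {f : ℝ → ℂ}, MemLp f 2 volume → IntervalIntegrable f volume (-1) y := fun hf =>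
    intervalIntegrable_of_locallyIntegrable (hf.locallyIntegrable (by norm_num)) _ _
  have e1 := integral_leibniz (lipschitzWith_cutoff hδ) hv.locallyIntegrable δ (-1) (F := F)
    (fun _ => rfl) (-1) y
  have e2 := integral_leibniz (χ := fun z => cutoff δ (z - δ))
    ((lipschitzWith_cutoff hδ).comp (g := fun z : ℝ => z - δ) (Kg := 1)
      (LipschitzWith.of_dist_le_mul fun a b => by simp))
    hv.locallyIntegrable (-δ) (-1) (F := F) (fun _ => rfl) (-1) y
  simp only [deriv_comp_sub_const, ← sub_eq_add_neg] at e2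
  rw [cutoff_eq_zero_of_le hδ (by linarith : (-1 : ℝ) - δ ≤ -1)] at e2
  rw [cutoff_eq_zero_of_le hδ le_rfl] at e1
  simp only [Complex.ofReal_zero, zero_mul, sub_zero] at e1 e2
  simp only [twistDeriv, twist, skew]
  rw [intervalIntegral.integral_add (hii hw)
    ((hii (memLp_skewDeriv hδ hFm hw)).const_mul _), intervalIntegral.integral_const_mul]
  simp only [skewDeriv]
  have i1 : IntervalIntegrable (fun z => ((deriv (cutoff δ) z : ℝ) : ℂ) * F (z + δ) +
      cutoff δ z * w (z + δ)) volume (-1) y := hii ((memLp_deriv_up hδ hFm).add (memLp_up hδ hw))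
  have i2 : IntervalIntegrable (fun z => ((deriv (cutoff δ) (z - δ) : ℝ) : ℂ) * F (z - δ) +
      cutoff δ (z - δ) * w (z - δ)) volume (-1) y :=
    hii ((memLp_deriv_down hδ hFm).add (memLp_down hδ hw))
  rw [intervalIntegral.integral_sub i1 i2, e1, e2]

/-- The conjugate of the multiplier applied to a function in `H^1_0(-1, 1)` is an admissible test
function; the conjugate appears because the weak formulation is bilinear. -/
lemma IsZeroExtH10.isH10_conj_twist (c : ℝ) (hδ : 0 < δ) (hv : IsZeroExtH10 v w) :
    IsH10 (fun y => starRingEnd ℂ (twist c δ v y))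
      (fun y => starRingEnd ℂ (twistDeriv c δ v w y)) := by
  have hconj : ∀ {y : ℝ}, -1 ≤ y → ∫ z in (-1 : ℝ)..y, starRingEnd ℂ (twistDeriv c δ v w z) =
      starRingEnd ℂ (twist c δ (fun y => ∫ z in (-1 : ℝ)..y, w z) y) := fun {y} hy => by
    rw [← hv.integral_twistDeriv c hδ, intervalIntegral.integral_of_le hy,
      intervalIntegral.integral_of_le hy, integral_conj]
  refine ⟨((memLp_twistDeriv c hδ hv.memLp hv.memLp_deriv).star).restrict _, ?_, ?_⟩
  · refine (ae_restrict_iff' measurableSet_Ioo).2 ?_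
    filter_upwards [hv.eq_primitive, ae_comp_add hv.eq_primitive δ,
      ae_comp_add hv.eq_primitive (-δ)] with z h0 h1 h2 hz
    rw [← sub_eq_add_neg] at h2
    rw [hconj hz.1.le]
    simp only [twist, skew, h0, h1, h2]
  · rw [hconj (by norm_num)]
    simp only [twist, skew]
    rw [cutoff_eq_zero_of_ge hδ (by linarith), cutoff_eq_zero_of_ge hδ le_rfl, hv.vanish_right]
    simp

/-! ### Dissipation -/

/-- The positive commutator of transport with the multiplier: shifting by `δ` costs
`δ ‖∂_y v‖`, and so does the loss in the boundary layers where the cut-off is not `1`. -/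
lemma IsZeroExtH10.integral_cutoff_inner_ge (hδ : 0 < δ) (hv : IsZeroExtH10 v w) :
    3 / 4 * (∫ y, ‖v y‖ ^ 2) - 6 * δ ^ 2 * ∫ y, ‖w y‖ ^ 2 ≤
      ∫ y, cutoff δ y * inner ℝ (v (y + δ)) (v y) := by
  have hm := hv.memLp
  have hd : MemLp (fun y => v (y + δ) - v y) 2 volume := (memLp_comp_add hm δ).sub hm
  have hl : MemLp (fun y => v (y - δ + δ) - v (y - δ)) 2 volume := memLp_comp_sub hd δ
  have hr : MemLp (fun y => v (y + 2 * δ) - v y) 2 volume := (memLp_comp_add hm _).sub hm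
  have n1 := hv.integral_norm_translate_sub_sq_le hδ.le
  have n2 := hv.integral_norm_translate_sub_sq_le (h := 2 * δ) (by linarith)
  have n3 : ∫ y, ‖v (y - δ + δ) - v (y - δ)‖ ^ 2 = ∫ y, ‖v (y + δ) - v y‖ ^ 2 :=
    integral_sub_right_eq_self (fun y => ‖v (y + δ) - v y‖ ^ 2) δ
  have hpt : ∀ᵐ y : ℝ, 3 / 4 * ‖v y‖ ^ 2 - (‖v (y + δ) - v y‖ ^ 2 +
      (‖v (y - δ + δ) - v (y - δ)‖ ^ 2 + ‖v (y + 2 * δ) - v y‖ ^ 2)) ≤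
      inner ℝ ((cutoff δ y : ℂ) * v (y + δ)) (v y) := by
    filter_upwards [hv.ae_eq_zero, ae_comp_add hv.ae_eq_zero (-δ),
      ae_comp_add hv.ae_eq_zero (2 * δ)] with y h0 h1 h2
    rw [← sub_eq_add_neg] at h1
    rw [inner_real_mul, sub_add_cancel]
    have h3 : inner ℝ (v (y + δ)) (v y) = ‖v y‖ ^ 2 + inner ℝ (v (y + δ) - v y) (v y) := by
      rw [inner_sub_left, real_inner_self_eq_norm_sq]
      ring
    have h4 := (abs_le.1 (abs_real_inner_le_norm (v (y + δ) - v y) (v y))).1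
    have c0 := cutoff_nonneg δ y
    have c1 := cutoff_le_one δ y
    -- Where the cut-off is not `1`, the point `y - δ` or the point `y + 2 δ` lies outside the
    -- channel, so that one of the two increments is `v y` itself.
    have h5 : (1 - cutoff δ y) * ‖v y‖ ^ 2 ≤ ‖v y - v (y - δ)‖ ^ 2 + ‖v (y + 2 * δ) - v y‖ ^ 2 := by
      by_cases hy1 : y - δ ≤ -1
      · rw [h1 fun hh => by linarith [hh.1], sub_zero]
        nlinarith [sq_nonneg ‖v y‖, sq_nonneg ‖v (y + 2 * δ) - v y‖]
      · by_cases hy2 : 1 ≤ y + 2 * δ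
        · rw [h2 fun hh => by linarith [hh.2], zero_sub, norm_neg]
          nlinarith [sq_nonneg ‖v y‖, sq_nonneg ‖v y - v (y - δ)‖]
        · rw [cutoff_eq_one hδ (by linarith) (by linarith)]
          nlinarith [sq_nonneg ‖v y - v (y - δ)‖, sq_nonneg ‖v (y + 2 * δ) - v y‖]
    have h6 : -(1 / 4 * ‖v y‖ ^ 2 + ‖v (y + δ) - v y‖ ^ 2) ≤
        cutoff δ y * inner ℝ (v (y + δ) - v y) (v y) := by
      have h7 : ‖v (y + δ) - v y‖ * ‖v y‖ ≤ 1 / 4 * ‖v y‖ ^ 2 + ‖v (y + δ) - v y‖ ^ 2 := by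
        nlinarith [sq_nonneg (‖v (y + δ) - v y‖ - 1 / 2 * ‖v y‖)]
      have h8 : 0 ≤ ‖v (y + δ) - v y‖ * ‖v y‖ := by positivity
      nlinarith
    rw [h3]
    nlinarith
  have hint := memLp_inner (memLp_up hδ hm) hm
  have hsum : Integrable (fun y => ‖v (y - δ + δ) - v (y - δ)‖ ^ 2 + ‖v (y + 2 * δ) - v y‖ ^ 2) :=
    (integrable_norm_sq hl).add (integrable_norm_sq hr)
  have hsum2 : Integrable (fun y => ‖v (y + δ) - v y‖ ^ 2 +
      (‖v (y - δ + δ) - v (y - δ)‖ ^ 2 + ‖v (y + 2 * δ) - v y‖ ^ 2)) :=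
    (integrable_norm_sq hd).add hsum
  have key := integral_mono_ae (((integrable_norm_sq hm).const_mul (3 / 4)).sub hsum2) hint hpt
  simp only [Pi.sub_apply] at key
  rw [integral_sub ((integrable_norm_sq hm).const_mul (3 / 4)) hsum2, integral_const_mul,
    integral_add (integrable_norm_sq hd) hsum,
    integral_add (integrable_norm_sq hl) (integrable_norm_sq hr), n3] at key
  simp only [inner_real_mul] at key
  nlinarith

lemma IsZeroExtH10.memLp_mul_id (hv : IsZeroExtH10 v w) :
    MemLp (fun y : ℝ => (y : ℂ) * v y) 2 volume := by
  refine hv.memLp.of_le_mul (c := 1)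
    ((Complex.continuous_ofReal.aestronglyMeasurable).mul hv.memLp.1) ?_
  filter_upwards [hv.ae_eq_zero] with y hy
  by_cases hm : y ∈ Ioo (-1 : ℝ) 1
  · rw [norm_mul, Complex.norm_real]
    exact mul_le_mul_of_nonneg_right (abs_le.2 ⟨hm.1.le, hm.2.le⟩) (norm_nonneg _)
  · rw [hy hm]
    simp

/-- The transport term enters the twisted energy through its commutator with the shift, which is a
multiple of the shift itself. -/
lemma IsZeroExtH10.integral_inner_twist_transport (c : ℝ) (hδ : 0 < δ) (hv : IsZeroExtH10 v w) :
    ∫ y, inner ℝ (twist c δ v y) (Complex.I * ((y : ℂ) * v y)) =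
      -(c * δ * ∫ y, cutoff δ y * inner ℝ (v (y + δ)) (v y)) := by
  have hm := hv.memLp
  have hyv := hv.memLp_mul_id
  rw [integral_inner_twist c hδ hm (u := fun y : ℝ => Complex.I * ((y : ℂ) * v y))
    (hyv.const_mul _)]
  simp only [inner_I_mul_I_mul]
  rw [integral_inner_skew hδ hm (u := fun y : ℝ => (y : ℂ) * v y) hyv]
  have h0 : ∀ y : ℝ, inner ℝ (v y) (Complex.I * ((y : ℂ) * v y)) = 0 := fun y => by
    simp only [Complex.inner, Complex.mul_re, Complex.mul_im, Complex.conj_re, Complex.conj_im,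
      Complex.I_re, Complex.I_im, Complex.ofReal_re, Complex.ofReal_im]
    ring
  have h1 : ∀ y : ℝ, cutoff δ y * (inner ℝ (v (y + δ)) ((y : ℂ) * v y) -
      inner ℝ (v y) (((y + δ : ℝ) : ℂ) * v (y + δ))) =
      -δ * (cutoff δ y * inner ℝ (v (y + δ)) (v y)) := fun y => by
    rw [inner_mul_real, inner_mul_real, real_inner_comm (v (y + δ)) (v y)]
    ring
  simp only [h0, h1]
  rw [integral_const_mul]
  simp
  ring

end

noncomputable section

/-- The part of the right-hand side of the equation that is paired with the test function itself. -/
def bulkForce (ν k : ℝ) (G₁ v : ℝ → ℂ) (y : ℝ) : ℂ :=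
  -((k : ℂ) * (Complex.I * G₁ y)) - (k : ℂ) * (Complex.I * ((y : ℂ) * v y))
    - ((ν * k ^ 2 : ℝ) : ℂ) * v y

/-- The part of the right-hand side of the equation that is paired with the derivative of the test
function. -/
def fluxForce (ν : ℝ) (G₂ w : ℝ → ℂ) (y : ℝ) : ℂ := G₂ y - (ν : ℂ) * w y

/-- The rate of change of half the twisted energy: the right-hand side of the equation tested with
the conjugate of `twist c δ v`. -/
def energyRate (ν k c δ : ℝ) (G₁ G₂ v w : ℝ → ℂ) : ℝ :=
  (∫ y, inner ℝ (twist c δ v y) (bulkForce ν k G₁ v y)) +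
    ∫ y, inner ℝ (twistDeriv c δ v w y) (fluxForce ν G₂ w y)

variable {ν k c δ : ℝ} {G₁ G₂ v w : ℝ → ℂ}

lemma IsZeroExtH10.energyRate_eq (ν k c : ℝ) (hδ : 0 < δ) (hv : IsZeroExtH10 v w)
    (h₁ : MemLp G₁ 2 volume) (h₂ : MemLp G₂ 2 volume) :
    energyRate ν k c δ G₁ G₂ v w =
      -(k * ∫ y, inner ℝ (twist c δ v y) (Complex.I * G₁ y))
      + k * (c * δ * ∫ y, cutoff δ y * inner ℝ (v (y + δ)) (v y))
      - ν * k ^ 2 * (∫ y, inner ℝ (twist c δ v y) (v y))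
      + (∫ y, inner ℝ (twistDeriv c δ v w y) (G₂ y))
      - ν * ∫ y, inner ℝ (twistDeriv c δ v w y) (w y) := by
  have hm := hv.memLp
  have hw := hv.memLp_deriv
  have hS := memLp_twist c hδ hm
  have hS' := memLp_twistDeriv c hδ hm hw
  have i1 := (memLp_inner hS (h₁.const_mul Complex.I)).const_mul k
  have i2 := (memLp_inner hS (hv.memLp_mul_id.const_mul Complex.I)).const_mul k
  have i3 := (memLp_inner hS hm).const_mul (ν * k ^ 2)
  have i4 := memLp_inner hS' h₂
  have i5 := (memLp_inner hS' hw).const_mul ν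
  have e := hv.integral_inner_twist_transport c hδ
  simp only [energyRate, bulkForce, fluxForce, inner_sub_right, inner_neg_right, inner_mul_real]
  have i6 : Integrable (fun y : ℝ => -(k * inner ℝ (twist c δ v y) (Complex.I * G₁ y)) -
      k * inner ℝ (twist c δ v y) (Complex.I * ((y : ℂ) * v y))) := i1.neg.sub i2
  have i7 : Integrable (fun y : ℝ => -(k * inner ℝ (twist c δ v y) (Complex.I * G₁ y))) := i1.neg
  rw [integral_sub i6 i3, integral_sub i7 i2, integral_neg, integral_const_mul,
    integral_const_mul, integral_const_mul, integral_sub i4 i5, integral_const_mul, e]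
  ring

lemma abs_integral_inner_I_skewDeriv_le (hδ : 0 < δ) (hv : MemLp v 2 volume)
    (hw : MemLp w 2 volume) :
    |∫ y, inner ℝ (Complex.I * skewDeriv δ v w y) (w y)| ≤
      33 / 4 * (∫ y, ‖w y‖ ^ 2) + 1 / 4 * (δ⁻¹ ^ 2 * ∫ y, ‖v y‖ ^ 2) := by
  have h := abs_integral_inner_le ((memLp_skewDeriv hδ hv hw).const_mul Complex.I) hw
    (a := 1 / 32) (b := 8) (by norm_num) (by norm_num) (by norm_num)
  simp only [norm_mul, Complex.norm_I, one_mul] at h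
  linarith [integral_norm_skewDeriv_sq_le hδ hv hw]

lemma abs_integral_inner_twist_forcing_le (hc : |c| ≤ 1 / 30) (hδ : 0 < δ) (hv : MemLp v 2 volume)
    (h₁ : MemLp G₁ 2 volume) {a : ℝ} (ha : 0 < a) :
    |k * ∫ y, inner ℝ (twist c δ v y) (Complex.I * G₁ y)| ≤
      a * (3 * ∫ y, ‖v y‖ ^ 2) + k ^ 2 / (4 * a) * ∫ y, ‖G₁ y‖ ^ 2 := by
  have h := abs_integral_inner_le (memLp_twist c hδ hv)
    (h₁.const_mul ((k : ℂ) * Complex.I)) (a := a) (b := 1 / (4 * a)) ha.le (by positivity)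
    (by field_simp; exact le_rfl)
  rw [integral_norm_const_I_mul_sq] at h
  simp only [mul_assoc, inner_mul_real] at h
  rw [integral_const_mul] at h
  refine h.trans (add_le_add (mul_le_mul_of_nonneg_left (integral_norm_twist_sq_le hc hδ hv) ha.le)
    (le_of_eq ?_))
  field_simp

lemma abs_integral_inner_twistDeriv_forcing_le (hν : 0 < ν) (hc : |c| ≤ 1 / 30) (hδ : 0 < δ)
    (hv : MemLp v 2 volume) (hw : MemLp w 2 volume) (h₂ : MemLp G₂ 2 volume) :
    |∫ y, inner ℝ (twistDeriv c δ v w y) (G₂ y)| ≤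
      ν / 12 * (3 * (∫ y, ‖w y‖ ^ 2) + 1 / 50 * (δ⁻¹ ^ 2 * ∫ y, ‖v y‖ ^ 2))
        + 3 / ν * ∫ y, ‖G₂ y‖ ^ 2 := by
  have h := abs_integral_inner_le (memLp_twistDeriv c hδ hv hw) h₂ (a := ν / 12) (b := 3 / ν)
    (by positivity) (by positivity) (by field_simp; norm_num)
  exact h.trans (add_le_add (mul_le_mul_of_nonneg_left
    (integral_norm_twistDeriv_sq_le hc hδ hv hw) (by positivity)) le_rfl)

/-- Enhanced dissipation. At the scale `δ` with `ν = |k| δ³`, the twist by `c = ∓ 1/30`, of sign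
opposite to that of `k`, makes transport dissipate at the rate `|k| δ = (ν k²)^{1/3}`; all errors
are absorbed by the viscous dissipation. -/
lemma IsZeroExtH10.energyRate_le_of_shear (hν : 0 < ν) (hδ : 0 < δ) (hscale : ν = |k| * δ ^ 3)
    (hc : c * k = -(1 / 30 * |k|)) (hc' : |c| ≤ 1 / 30) (hv : IsZeroExtH10 v w)
    (h₁ : MemLp G₁ 2 volume) (h₂ : MemLp G₂ 2 volume) :
    energyRate ν k c δ G₁ G₂ v w ≤ -(|k| * δ / 100 * ∫ y, ‖v y‖ ^ 2)
      + 150 * (|k| / δ) * (∫ y, ‖G₁ y‖ ^ 2) + 3 / ν * ∫ y, ‖G₂ y‖ ^ 2 := by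
  have hm := hv.memLp
  have hw := hv.memLp_deriv
  have hk : 0 < |k| := by
    refine (abs_nonneg k).lt_of_ne fun h0 => ?_
    rw [← h0] at hscale
    linarith
  rw [hv.energyRate_eq ν k c hδ h₁ h₂]
  have t1 := (abs_le.1 (abs_integral_inner_twist_forcing_le (k := k) hc' hδ hm h₁
    (a := |k| * δ / 600) (by positivity))).1
  have t2 := hv.integral_cutoff_inner_ge hδ
  have t3 := half_le_integral_inner_twist hc' hδ hm
  have t4 := (abs_le.1 (abs_integral_inner_twistDeriv_forcing_le hν hc' hδ hm hw h₂)).2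
  have t5 := abs_integral_inner_I_skewDeriv_le hδ hm hw
  rw [integral_inner_twistDeriv c hδ hm hw hw, integral_inner_self_eq]
  set N₀ := ∫ y, ‖v y‖ ^ 2 with hN₀
  set N₁ := ∫ y, ‖w y‖ ^ 2 with hN₁
  have n0 : 0 ≤ N₀ := integral_norm_sq_nonneg volume v
  have n1 : 0 ≤ N₁ := integral_norm_sq_nonneg volume w
  set X := ∫ y, cutoff δ y * inner ℝ (v (y + δ)) (v y)
  set Y := ∫ y, inner ℝ (Complex.I * skewDeriv δ v w y) (w y)
  have t6 : -(1 / 30 * (33 / 4 * N₁ + 1 / 4 * (δ⁻¹ ^ 2 * N₀))) ≤ c * Y := by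
    have : |c * Y| ≤ 1 / 30 * (33 / 4 * N₁ + 1 / 4 * (δ⁻¹ ^ 2 * N₀)) := by
      rw [abs_mul]
      exact mul_le_mul hc' t5 (abs_nonneg _) (by norm_num)
    exact (abs_le.1 this).1
  have hδν : ν * (δ⁻¹ ^ 2 * N₀) = |k| * δ * N₀ := by
    rw [hscale]
    field_simp
  have e1 : k ^ 2 / (4 * (|k| * δ / 600)) = 150 * (|k| / δ) := by
    rw [← sq_abs]
    field_simp
    norm_num
  rw [e1] at t1
  -- The error `6 δ² N₁` of the commutator estimate costs `ν N₁ / 5`, the one in `t6`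
  -- costs `11 ν N₁ / 40`, and the forcing in `t4` costs `ν N₁ / 4`: less than `ν N₁` in total.
  have t7 : k * (c * δ * X) ≤ -(1 / 30 * (|k| * δ) * (3 / 4 * N₀)) + 1 / 5 * (ν * N₁) := by
    have e2 : k * (c * δ * X) = -(1 / 30 * (|k| * δ) * X) := by
      linear_combination δ * X * hc
    have e3 : |k| * δ * (6 * δ ^ 2 * N₁) = 6 * (ν * N₁) := by
      rw [hscale]
      ring
    have e4 := mul_le_mul_of_nonneg_left t2 (by positivity : 0 ≤ 1 / 30 * (|k| * δ))
    linarith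
  have t8 : 0 ≤ ν * k ^ 2 * (∫ y, inner ℝ (twist c δ v y) (v y)) :=
    mul_nonneg (by positivity) (by linarith)
  have t9 := mul_le_mul_of_nonneg_left t6 hν.le
  have p1 : 0 ≤ ν * N₁ := by positivity
  have p2 : 0 ≤ |k| * δ * N₀ := by positivity
  nlinarith

/-- Without twist (so that the scale, here `1 / 2`, plays no role) the viscous
dissipation and the Poincaré inequality give decay at the rate `ν`. -/
lemma IsZeroExtH10.energyRate_le_of_viscous (hν : 0 < ν) (hv : IsZeroExtH10 v w)
    (h₁ : MemLp G₁ 2 volume) (h₂ : MemLp G₂ 2 volume) :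
    energyRate ν k 0 (1 / 2) G₁ G₂ v w ≤ -(ν / 8 * ∫ y, ‖v y‖ ^ 2)
      + 16 * (k ^ 2 / ν) * (∫ y, ‖G₁ y‖ ^ 2) + 3 / ν * ∫ y, ‖G₂ y‖ ^ 2 := by
  have hδ : (0 : ℝ) < 1 / 2 := by norm_num
  have hc : |(0 : ℝ)| ≤ 1 / 30 := by norm_num
  have hm := hv.memLp
  have hw := hv.memLp_deriv
  rw [hv.energyRate_eq ν k 0 hδ h₁ h₂]
  have t1 := (abs_le.1 (abs_integral_inner_twist_forcing_le (k := k) hc hδ hm h₁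
    (a := ν / 64) (by positivity))).1
  have t3 := half_le_integral_inner_twist hc hδ hm
  have t4 := (abs_le.1 (abs_integral_inner_twistDeriv_forcing_le hν hc hδ hm hw h₂)).2
  have t5 := hv.poincare
  rw [integral_inner_twistDeriv 0 hδ hm hw hw, integral_inner_self_eq]
  have n0 := integral_norm_sq_nonneg volume v
  have e1 : k ^ 2 / (4 * (ν / 64)) = 16 * (k ^ 2 / ν) := by
    field_simp
    ring
  have e2 : ((1 / 2 : ℝ)⁻¹ ^ 2) = 4 := by norm_num
  rw [e1] at t1
  rw [e2] at t4
  have t8 : 0 ≤ ν * k ^ 2 * (∫ y, inner ℝ (twist 0 (1 / 2) v y) (v y)) :=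
    mul_nonneg (by positivity) (by linarith)
  have p0 := mul_nonneg hν.le n0
  have p1 := mul_le_mul_of_nonneg_left t5 hν.le
  nlinarith

end

noncomputable section

/-! ### Correlation kernels -/

/-- The properties of a correlation `p s t = ∫ ⟨ψ(t, y), f(s, y)⟩ dy` of two square-integrable
functions of time and space that the energy method uses: `p` is dominated by the sum of an
integrable function of `s` and one of `t`, and its integrals along the lines parallel to the
diagonal depend continuously on the line, at the diagonal. -/
structure IsCorrelation (p : ℝ → ℝ → ℝ) : Prop where
  aestronglyMeasurable :
    AEStronglyMeasurable (fun z : ℝ × ℝ => p z.1 z.2) (volume.prod volume)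
  dominated : ∃ α β : ℝ → ℝ, Integrable α ∧ Integrable β ∧
    ∀ᵐ z : ℝ × ℝ ∂volume.prod volume, |p z.1 z.2| ≤ α z.1 + β z.2
  integrable_diag : Integrable fun t => p t t
  integrable_line : ∀ u h : ℝ, Integrable fun t => p (t + u) (t + h)
  tendsto_line : ∀ b : ℝ, Tendsto (fun q : ℝ × ℝ => ∫ t in Ioc 0 b, p (t + q.1) (t + q.2))
    (𝓝 0) (𝓝 (∫ t in Ioc 0 b, p t t))

lemma IsCorrelation.add {p q : ℝ → ℝ → ℝ} (hp : IsCorrelation p) (hq : IsCorrelation q) :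
    IsCorrelation fun s t => p s t + q s t := by
  obtain ⟨α, β, hα, hβ, h⟩ := hp.dominated
  obtain ⟨α', β', hα', hβ', h'⟩ := hq.dominated
  refine ⟨hp.1.add hq.1, ⟨_, _, hα.add hα', hβ.add hβ', ?_⟩, hp.3.add hq.3,
    fun u h => (hp.4 u h).add (hq.4 u h), fun b => ?_⟩
  · filter_upwards [h, h'] with z h1 h2
    have := abs_add_le (p z.1 z.2) (q z.1 z.2)
    simp only [Pi.add_apply]
    linarith
  · have h1 := (hp.tendsto_line b).add (hq.tendsto_line b)
    rw [← integral_add hp.3.restrict hq.3.restrict] at h1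
    refine h1.congr fun z => ?_
    rw [← integral_add (hp.4 _ _).restrict (hq.4 _ _).restrict]

lemma measurePreserving_timeShift (u : ℝ) :
    MeasurePreserving (fun z : ℝ × ℝ => (z.1 + u, z.2)) (volume.prod volume)
      (volume.prod volume) :=
  (measurePreserving_add_right volume u).prod (MeasurePreserving.id volume)

/-- Translation in time as a continuous map of space-time. -/
def timeShift (u : ℝ) : C(ℝ × ℝ, ℝ × ℝ) := ⟨fun z => (z.1 + u, z.2), by fun_prop⟩

lemma continuous_timeShift : Continuous timeShift :=
  (ContinuousMap.curry ⟨fun q : ℝ × (ℝ × ℝ) => (q.2.1 + q.1, q.2.2), by fun_prop⟩).continuous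

lemma ae_memLp_slice {f : ℝ × ℝ → ℂ} (hf : MemLp f 2 (volume.prod volume)) :
    ∀ᵐ t : ℝ, MemLp (fun y => f (t, y)) 2 volume := by
  filter_upwards [(integrable_norm_sq hf).prod_right_ae, hf.1.prodMk_left] with t h1 h2
  exact (memLp_two_iff_integrable_sq_norm h2).2 h1

/-- The correlation in space of two square-integrable functions of time and space is continuous
under relative translations in time, since translations are continuous on `L²`. -/
lemma isCorrelation_integral_inner {f ψ : ℝ × ℝ → ℂ} (hf : MemLp f 2 (volume.prod volume))
    (hψ : MemLp ψ 2 (volume.prod volume)) :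
    IsCorrelation fun s t => ∫ y, inner ℝ (ψ (t, y)) (f (s, y)) := by
  have hshift : ∀ {g : ℝ × ℝ → ℂ}, MemLp g 2 (volume.prod volume) → ∀ u : ℝ,
      MemLp (fun z : ℝ × ℝ => g (z.1 + u, z.2)) 2 (volume.prod volume) := fun hg u =>
    hg.comp_measurePreserving (measurePreserving_timeShift u)
  have hline : ∀ u h : ℝ, Integrable (fun z : ℝ × ℝ =>
      (inner ℝ (ψ (z.1 + h, z.2)) (f (z.1 + u, z.2)) : ℝ)) (volume.prod volume) := fun u h =>
    memLp_inner (hshift hψ h) (hshift hf u)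
  refine ⟨?_, ⟨fun s => ∫ y, ‖f (s, y)‖ ^ 2, fun t => ∫ y, ‖ψ (t, y)‖ ^ 2,
    (integrable_norm_sq hf).integral_prod_left, (integrable_norm_sq hψ).integral_prod_left, ?_⟩,
    (memLp_inner hψ hf).integral_prod_left, fun u h => (hline u h).integral_prod_left, fun b => ?_⟩
  · have m1 : AEStronglyMeasurable (fun z : (ℝ × ℝ) × ℝ => f (z.1.1, z.2))
        ((volume.prod volume).prod volume) :=
      hf.1.comp_quasiMeasurePreserving
        (MeasureTheory.QuasiMeasurePreserving.prodMap Measure.quasiMeasurePreserving_fst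
          (Measure.QuasiMeasurePreserving.id volume))
    have m2 : AEStronglyMeasurable (fun z : (ℝ × ℝ) × ℝ => ψ (z.1.2, z.2))
        ((volume.prod volume).prod volume) :=
      hψ.1.comp_quasiMeasurePreserving
        (MeasureTheory.QuasiMeasurePreserving.prodMap Measure.quasiMeasurePreserving_snd
          (Measure.QuasiMeasurePreserving.id volume))
    exact (m2.inner m1 : AEStronglyMeasurable (fun z : (ℝ × ℝ) × ℝ =>
      (inner ℝ (ψ (z.1.2, z.2)) (f (z.1.1, z.2)) : ℝ)) _).integral_prod_right'
  · filter_upwards [Measure.quasiMeasurePreserving_fst.ae (ae_memLp_slice hf),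
      Measure.quasiMeasurePreserving_snd.ae (ae_memLp_slice hψ)] with z h1 h2
    have := abs_integral_inner_le h2 h1 (a := 1) (b := 1) (by norm_num) (by norm_num) (by norm_num)
    linarith
  · have hA : ∀ u h : ℝ,
        ∫ t in Ioc 0 b, (∫ y, inner ℝ (ψ (t + h, y)) (f (t + u, y))) =
        ∫ z in Ioc 0 b ×ˢ univ, (inner ℝ (ψ (z.1 + h, z.2)) (f (z.1 + u, z.2)) : ℝ)
          ∂volume.prod volume := fun u h => by
      rw [← Measure.prod_restrict, Measure.restrict_univ, integral_prod]
      have := (hline u h).restrict (s := Ioc 0 b ×ˢ univ)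
      rwa [← Measure.prod_restrict, Measure.restrict_univ] at this
    have hT : ∀ {g : ℝ × ℝ → ℂ} (hg : MemLp g 2 (volume.prod volume)) (π : ℝ × ℝ → ℝ),
        Tendsto π (𝓝 0) (𝓝 0) → Tendsto (fun q : ℝ × ℝ =>
          LpToLpRestrictCLM (ℝ × ℝ) ℂ ℝ (volume.prod volume) 2 (Ioc 0 b ×ˢ univ)
            ((hshift hg (π q)).toLp _)) (𝓝 0)
          (𝓝 (LpToLpRestrictCLM (ℝ × ℝ) ℂ ℝ (volume.prod volume) 2 (Ioc 0 b ×ˢ univ)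
            ((hshift hg 0).toLp _))) := fun {g} hg π hπ => by
      refine ((ContinuousLinearMap.continuous _).tendsto _).comp ?_
      exact (tendsto_const_nhds (x := hg.toLp g)).compMeasurePreservingLp
        ((continuous_timeShift.tendsto 0).comp hπ)
        (fun q => measurePreserving_timeShift (π q)) (measurePreserving_timeShift 0) (by norm_num)
    have hlim := (hT hψ Prod.snd (continuous_snd.tendsto' _ _ rfl)).inner (𝕜 := ℝ)
      (hT hf Prod.fst (continuous_fst.tendsto' _ _ rfl))
    have hval : ∀ u h : ℝ,
        inner ℝ (LpToLpRestrictCLM (ℝ × ℝ) ℂ ℝ (volume.prod volume) 2 (Ioc 0 b ×ˢ univ)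
            ((hshift hψ h).toLp _))
          (LpToLpRestrictCLM (ℝ × ℝ) ℂ ℝ (volume.prod volume) 2 (Ioc 0 b ×ˢ univ)
            ((hshift hf u).toLp _)) =
        ∫ t in Ioc 0 b, (∫ y, inner ℝ (ψ (t + h, y)) (f (t + u, y)) : ℝ) := fun u h => by
      rw [hA, L2.inner_def]
      refine integral_congr_ae ?_
      filter_upwards [LpToLpRestrictCLM_coeFn ℝ (Ioc 0 b ×ˢ univ) ((hshift hψ h).toLp _),
        LpToLpRestrictCLM_coeFn ℝ (Ioc 0 b ×ˢ univ) ((hshift hf u).toLp _),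
        ae_restrict_of_ae (hshift hψ h).coeFn_toLp, ae_restrict_of_ae (hshift hf u).coeFn_toLp]
        with z h1 h2 h3 h4
      rw [h1, h2, h3, h4]
    rw [hval] at hlim
    simp only [add_zero] at hlim
    exact hlim.congr fun q => hval q.1 q.2

lemma IsCorrelation.integrable_square {p : ℝ → ℝ → ℝ} (hp : IsCorrelation p) (a b : ℝ) :
    Integrable (fun z : ℝ × ℝ => p z.1 z.2)
      ((volume.restrict (Ioc 0 a)).prod (volume.restrict (Ioc 0 b))) := by
  obtain ⟨α, β, hα, hβ, h⟩ := hp.dominated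
  have hle : (volume.restrict (Ioc 0 a)).prod (volume.restrict (Ioc 0 b)) ≪
      (volume.prod volume : Measure (ℝ × ℝ)) := by
    rw [Measure.prod_restrict]
    exact Measure.absolutelyContinuous_of_le Measure.restrict_le_self
  refine ((hα.restrict (s := Ioc 0 a)).comp_fst _ |>.add
    ((hβ.restrict (s := Ioc 0 b)).comp_snd _)).mono' (hp.1.mono_ac hle) (hle.ae_le h)

lemma IsCorrelation.integrable_shear {p : ℝ → ℝ → ℝ} (hp : IsCorrelation p) (b h h' : ℝ) :
    Integrable (fun z : ℝ × ℝ => p (z.1 + z.2) (z.1 + h'))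
      ((volume.restrict (Ioc 0 b)).prod (volume.restrict (Ioc 0 h))) := by
  obtain ⟨α, β, hα, hβ, hd⟩ := hp.dominated
  have hle : (volume.restrict (Ioc 0 b)).prod (volume.restrict (Ioc 0 h)) ≪
      (volume.prod volume : Measure (ℝ × ℝ)) := by
    rw [Measure.prod_restrict]
    exact Measure.absolutelyContinuous_of_le Measure.restrict_le_self
  have hΦ : MeasurePreserving (fun z : ℝ × ℝ => (z.1 + z.2, z.1 + h')) (volume.prod volume)
      (volume.prod volume) :=
    (((MeasurePreserving.id volume).prod (measurePreserving_add_right volume h')).comp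
      Measure.measurePreserving_swap).comp (measurePreserving_prod_add volume volume)
  have i1 : Integrable (fun z : ℝ × ℝ => α (z.1 + z.2))
      ((volume.restrict (Ioc 0 b)).prod (volume.restrict (Ioc 0 h))) := by
    have h3 : MeasurePreserving (fun z : ℝ × ℝ => (z.1 + z.2, z.2))
      (volume.prod (volume.restrict (Ioc 0 h))) (volume.prod (volume.restrict (Ioc 0 h))) :=
      measurePreserving_add_prod volume (volume.restrict (Ioc 0 h))
    have h4 : Integrable (fun z : ℝ × ℝ => α (z.1 + z.2))
        (volume.prod (volume.restrict (Ioc 0 h))) :=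
      h3.integrable_comp_of_integrable (hα.comp_fst (volume.restrict (Ioc 0 h)))
    refine h4.mono_measure ?_
    exact Measure.prod_mono Measure.restrict_le_self le_rfl
  have i2 : Integrable (fun z : ℝ × ℝ => β (z.1 + h'))
      ((volume.restrict (Ioc 0 b)).prod (volume.restrict (Ioc 0 h))) :=
    ((hβ.comp_add_right h').restrict (s := Ioc 0 b)).comp_fst _
  exact (i1.add i2).mono'
    ((hp.1.comp_quasiMeasurePreserving hΦ.quasiMeasurePreserving).mono_ac hle)
    (hle.ae_le (hΦ.quasiMeasurePreserving.ae hd))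

end

noncomputable section

/-! ### The energy inequality for weak solutions -/

section Energy

variable {a p : ℝ → ℝ → ℝ} {I : ℝ → ℝ} {T K : ℝ} {good : ℝ → Prop}

/-- Averaging in `t` the increments of the energy over time steps of length `h`. With `r = t + h`,
symmetry of `a` turns `a r r - a t t` into `(a r r - a t r) + (a r t - a t t)`, and each bracket is
an integral of `p` over the time step. -/
lemma integral_energy_increment (hp : IsCorrelation p) (he : Integrable fun t => a t t)
    (hgood : ∀ᵐ t : ℝ, t ∈ Ioo 0 T → good t)
    (hsymm : ∀ t r, good t → good r → a t r = a r t)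
    (hweak : ∀ t r, good t → good r → a t r = I r + ∫ s in (0 : ℝ)..t, p s r)
    {b h : ℝ} (hb : 0 < b) (hh : 0 < h) (hbh : b + h < T) :
    ∫ t in b..b + h, a t t = (∫ t in (0 : ℝ)..h, a t t) +
      ∫ u in (0 : ℝ)..h, ((∫ t in Ioc 0 b, p (t + u) (t + h)) + ∫ t in Ioc 0 b, p (t + u) t) := by
  have hii : ∀ x y : ℝ, IntervalIntegrable (fun t => a t t) volume x y := fun x y =>
    he.intervalIntegrable
  have hi : ∀ x y : ℝ, IntervalIntegrable (fun t => a (t + h) (t + h)) volume x y := fun x y =>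
    (he.comp_add_right h).intervalIntegrable
  have s1 := hp.integrable_shear b h h
  have s2 := hp.integrable_shear b h 0
  simp only [add_zero] at s2
  have hsl : ∀ᵐ r : ℝ, r ∈ Ioc 0 T → IntegrableOn (fun s => p s r) (Ioc 0 T) :=
    (ae_restrict_iff' measurableSet_Ioc).1 (hp.integrable_square T T).prod_left_ae
  have hinc : ∀ᵐ t : ℝ, t ∈ Ioc 0 b → a (t + h) (t + h) - a t t =
      ∫ u in Ioc 0 h, (p (t + u) (t + h) + p (t + u) t) := by
    filter_upwards [hgood, ae_comp_add hgood h, hsl, ae_comp_add hsl h] with t g1 g2 h1 h2 ht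
    have ht1 : t ∈ Ioc 0 T := ⟨ht.1, by linarith [ht.2]⟩
    have ht2 : t + h ∈ Ioc 0 T := ⟨by linarith [ht.1], by linarith [ht.2]⟩
    have G1 := g1 ⟨ht.1, by linarith [ht.2]⟩
    have G2 := g2 ⟨by linarith [ht.1], by linarith [ht.2]⟩
    have i1 := h1 ht1
    have i2 := h2 ht2
    have step : ∀ r, IntegrableOn (fun s => p s r) (Ioc 0 T) →
        (∫ s in (0 : ℝ)..t + h, p s r) - (∫ s in (0 : ℝ)..t, p s r) =
          ∫ u in Ioc 0 h, p (t + u) r ∧ IntegrableOn (fun u => p (t + u) r) (Ioc 0 h) := by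
      intro r hr
      have j1 : IntervalIntegrable (fun s => p s r) volume 0 t :=
        (intervalIntegrable_iff_integrableOn_Ioc_of_le ht1.1.le).2
          (hr.mono_set (Ioc_subset_Ioc_right ht1.2))
      have j2 : IntervalIntegrable (fun s => p s r) volume 0 (t + h) :=
        (intervalIntegrable_iff_integrableOn_Ioc_of_le ht2.1.le).2
          (hr.mono_set (Ioc_subset_Ioc_right ht2.2))
      constructor
      · rw [intervalIntegral.integral_interval_sub_left j2 j1,
          ← intervalIntegral.integral_of_le hh.le,
          intervalIntegral.integral_comp_add_left (fun s => p s r) t, add_zero]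
      · rw [← intervalIntegrable_iff_integrableOn_Ioc_of_le hh.le]
        have j3 := (j1.symm.trans j2).comp_add_left t
        simpa using j3
    obtain ⟨q1, k1⟩ := step t i1
    obtain ⟨q2, k2⟩ := step (t + h) i2
    rw [integral_add k2 k1, ← q1, ← q2]
    linarith [hweak _ _ G2 G2, hweak _ _ G1 G2, hweak _ _ G2 G1, hweak _ _ G1 G1, hsymm _ _ G1 G2]
  have e1 : ∫ t in Ioc 0 b, (a (t + h) (t + h) - a t t) =
      ∫ u in (0 : ℝ)..h, ((∫ t in Ioc 0 b, p (t + u) (t + h)) + ∫ t in Ioc 0 b, p (t + u) t) := by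
    rw [setIntegral_congr_ae measurableSet_Ioc hinc, integral_integral_swap (s1.add s2),
      intervalIntegral.integral_of_le hh.le]
    refine integral_congr_ae ?_
    filter_upwards [s1.prod_left_ae, s2.prod_left_ae] with u h1 h2
    exact integral_add h1 h2
  rw [← e1, ← intervalIntegral.integral_of_le hb.le,
    intervalIntegral.integral_sub (hi _ _) (hii _ _),
    intervalIntegral.integral_comp_add_right (fun t => a t t) h, zero_add]
  have := intervalIntegral.integral_add_adjacent_intervals (hii 0 h) (hii h (b + h))
  have := intervalIntegral.integral_add_adjacent_intervals (hii 0 b) (hii b (b + h))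
  linarith

/-- The average of the energy over a short initial time interval is controlled by the initial
energy. -/
lemma integral_energy_initial_le (hp : IsCorrelation p) (he : Integrable fun t => a t t)
    (hgood : ∀ᵐ t : ℝ, t ∈ Ioo 0 T → good t)
    (hweak : ∀ t r, good t → good r → a t r = I r + ∫ s in (0 : ℝ)..t, p s r)
    (hI : ∀ t, good t → I t ≤ K / 2 + a t t / 2) {α β : ℝ → ℝ} (hα : Integrable α)
    (hβ : Integrable β)
    (hd : ∀ᵐ z : ℝ × ℝ ∂volume.prod volume, |p z.1 z.2| ≤ α z.1 + β z.2)
    {h : ℝ} (hh : 0 < h) (hT : h < T) :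
    ∫ t in (0 : ℝ)..h, a t t ≤
      h * (K + 2 * ((∫ s in (0 : ℝ)..h, α s) + ∫ s in (0 : ℝ)..h, β s)) := by
  have hd' : ∀ᵐ t : ℝ, ∀ᵐ s : ℝ, |p s t| ≤ α s + β t :=
    Measure.ae_ae_of_ae_prod (Measure.measurePreserving_swap.quasiMeasurePreserving.ae hd)
  have hsl : ∀ᵐ r : ℝ, r ∈ Ioc 0 T → IntegrableOn (fun s => p s r) (Ioc 0 T) :=
    (ae_restrict_iff' measurableSet_Ioc).1 (hp.integrable_square T T).prod_left_ae
  -- Half of `a t t` is absorbed from `I t`; the rest is an integral of `p` over `(0, t)`.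
  set A := ∫ s in (0 : ℝ)..h, α s with hA
  have hpt : ∀ᵐ t : ℝ, t ∈ Ioc 0 h → a t t ≤ K + 2 * (A + h * β t) := by
    filter_upwards [hgood, hd', hsl] with t g1 h1 h2 ht
    have G := g1 ⟨ht.1, by linarith [ht.2]⟩
    have i1 : IntegrableOn (fun s => p s t) (Ioc 0 h) :=
      (h2 ⟨ht.1, by linarith [ht.2]⟩).mono_set (Ioc_subset_Ioc_right hT.le)
    have i2 : Integrable (fun s => α s + β t) (volume.restrict (Ioc 0 h)) :=
      hα.restrict.add (by simp)
    have h3 : ∫ s in (0 : ℝ)..t, p s t ≤ ∫ s in Ioc 0 h, (α s + β t) := by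
      rw [intervalIntegral.integral_of_le ht.1.le]
      calc ∫ s in Ioc 0 t, p s t ≤ ∫ s in Ioc 0 t, |p s t| :=
            integral_mono (i1.mono_set (Ioc_subset_Ioc_right ht.2))
              (i1.mono_set (Ioc_subset_Ioc_right ht.2)).abs fun s => le_abs_self _
        _ ≤ ∫ s in Ioc 0 h, |p s t| :=
            setIntegral_mono_set i1.abs (Eventually.of_forall fun s => abs_nonneg _)
              (Ioc_subset_Ioc_right ht.2).eventuallyLE
        _ ≤ ∫ s in Ioc 0 h, (α s + β t) := integral_mono_ae i1.abs i2 (ae_restrict_of_ae h1)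
    rw [integral_add hα.restrict (by simp), setIntegral_const,
      ← intervalIntegral.integral_of_le hh.le, ← hA] at h3
    simp only [Real.volume_real_Ioc_of_le hh.le, sub_zero, smul_eq_mul] at h3
    have := hweak t t G G
    have := hI t G
    linarith
  have i3 : IntervalIntegrable (fun t => K + 2 * (A + h * β t)) volume 0 h :=
    (intervalIntegrable_const).add
      ((intervalIntegrable_const.add (hβ.intervalIntegrable.const_mul h)).const_mul 2)
  have h4 : ∫ t in (0 : ℝ)..h, a t t ≤ ∫ t in (0 : ℝ)..h, (K + 2 * (A + h * β t)) := by
    rw [intervalIntegral.integral_of_le hh.le, intervalIntegral.integral_of_le hh.le]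
    exact setIntegral_mono_ae_restrict he.integrableOn
      ((intervalIntegrable_iff_integrableOn_Ioc_of_le hh.le).1 i3)
      ((ae_restrict_iff' measurableSet_Ioc).2 hpt)
  refine h4.trans (le_of_eq ?_)
  rw [intervalIntegral.integral_add intervalIntegrable_const
      ((intervalIntegrable_const.add (hβ.intervalIntegrable.const_mul h)).const_mul 2),
    intervalIntegral.integral_const_mul, intervalIntegral.integral_add intervalIntegrable_const
      (hβ.intervalIntegrable.const_mul h), intervalIntegral.integral_const_mul]
  simp only [intervalIntegral.integral_const, sub_zero, smul_eq_mul]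
  ring

/-- The energy inequality in abstract form. Here `a t r` stands for the pairing of the solution at
time `t` with the multiplier applied to the solution at time `r`, and `I r` for the same with the
initial datum. -/
theorem energy_le_of_weak (hp : IsCorrelation p) (he : Integrable fun t => a t t)
    (hgood : ∀ᵐ t : ℝ, t ∈ Ioo 0 T → good t)
    (hsymm : ∀ t r, good t → good r → a t r = a r t)
    (hweak : ∀ t r, good t → good r → a t r = I r + ∫ s in (0 : ℝ)..t, p s r)
    (hI : ∀ t, good t → I t ≤ K / 2 + a t t / 2) :
    ∀ᵐ b : ℝ, b ∈ Ioo 0 T → a b b ≤ K + 2 * ∫ t in Ioc 0 b, p t t := by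
  obtain ⟨α, β, hα, hβ, hd⟩ := hp.dominated
  filter_upwards [_root_.LocallyIntegrable.ae_hasDerivAt_integral he.locallyIntegrable]
    with b hderiv hb
  set J := ∫ t in Ioc 0 b, p t t with hJ
  refine le_of_forall_pos_le_add fun η hη => ?_
  have hslope := (hderiv b).tendsto_slope_zero_right
  have hprim : ∀ {γ : ℝ → ℝ}, Integrable γ →
      Tendsto (fun h : ℝ => ∫ s in (0 : ℝ)..h, γ s) (𝓝[>] 0) (𝓝 0) := fun {γ} hγ => by
    have := (intervalIntegral.continuous_primitive (fun _ _ => hγ.intervalIntegrable) 0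
      (f := γ)).tendsto' 0 0 (by simp)
    exact this.mono_left nhdsWithin_le_nhds
  have hlim : Tendsto (fun h : ℝ => K + 2 * ((∫ s in (0 : ℝ)..h, α s) + ∫ s in (0 : ℝ)..h, β s)
      + 2 * J + η) (𝓝[>] 0) (𝓝 (K + 2 * (0 + 0) + 2 * J + η)) :=
    ((tendsto_const_nhds.add (((hprim hα).add (hprim hβ)).const_mul 2)).add_const _).add_const _
  have hclose : ∀ᶠ h : ℝ in 𝓝[>] 0, ∀ u ∈ Icc 0 h, ∀ h' ∈ Icc 0 h,
      ∫ t in Ioc 0 b, p (t + u) (t + h') < J + η / 2 := by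
    have h1 := (hp.tendsto_line b).eventually (gt_mem_nhds (by linarith : J < J + η / 2))
    obtain ⟨r, hr, hball⟩ := Metric.eventually_nhds_iff.1 h1
    filter_upwards [Ioo_mem_nhdsGT hr] with h hh u hu h' hh'
    refine hball (y := (u, h')) ?_
    rw [dist_zero_right, Prod.norm_def, max_lt_iff, Real.norm_eq_abs, Real.norm_eq_abs,
      abs_of_nonneg hu.1, abs_of_nonneg hh'.1]
    exact ⟨hu.2.trans_lt hh.2, hh'.2.trans_lt hh.2⟩
  have hfin := le_of_tendsto_of_tendsto hslope hlim (by
    filter_upwards [hclose, Ioo_mem_nhdsGT (show 0 < T - b by linarith [hb.2])] with h hc hh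
    have hbh : b + h < T := by linarith [hh.2]
    have e1 := integral_energy_increment hp he hgood hsymm hweak hb.1 hh.1 hbh
    have e2 := integral_energy_initial_le hp he hgood hweak hI hα hβ hd hh.1 (by linarith [hb.1])
    have s1 := (hp.integrable_shear b h h).integral_prod_right
    have s2 := (hp.integrable_shear b h 0).integral_prod_right
    simp only [add_zero] at s2
    have e3 : ∫ u in (0 : ℝ)..h, ((∫ t in Ioc 0 b, p (t + u) (t + h)) +
        ∫ t in Ioc 0 b, p (t + u) t) ≤ ∫ _u in (0 : ℝ)..h, (2 * J + η) := by
      refine intervalIntegral.integral_mono_on hh.1.le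
        ((intervalIntegrable_iff_integrableOn_Ioc_of_le hh.1.le).2 (s1.add s2))
        intervalIntegrable_const fun u hu => ?_
      have c1 := hc u hu h ⟨hh.1.le, le_rfl⟩
      have c2 := hc u hu 0 ⟨le_rfl, hh.1.le⟩
      simp only [add_zero] at c2
      linarith
    rw [intervalIntegral.integral_const, sub_zero, smul_eq_mul] at e3
    rw [intervalIntegral.integral_same, sub_zero, smul_eq_mul, inv_mul_le_iff₀ hh.1, e1]
    linarith)
  linarith

end Energy

end

noncomputable section

/-! ### The twisted energy of a weak solution -/

/-- The restriction of a function of time and space to `0 < t < T`, `-1 < y < 1`, extended by zero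
to the plane. -/
def extend (T : ℝ) (f : ℝ → ℝ → ℂ) : ℝ × ℝ → ℂ :=
  (Ioo 0 T ×ˢ Ioo (-1 : ℝ) 1).indicator fun z => f z.1 z.2

variable {T δ : ℝ} {f : ℝ → ℝ → ℂ}

lemma extend_slice {t : ℝ} (ht : t ∈ Ioo 0 T) (f : ℝ → ℝ → ℂ) :
    (fun y => extend T f (t, y)) = (Ioo (-1 : ℝ) 1).indicator (f t) := by
  ext y
  by_cases hy : y ∈ Ioo (-1 : ℝ) 1
  · rw [extend, indicator_of_mem hy, indicator_of_mem (mk_mem_prod ht hy)]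
  · rw [extend, indicator_of_notMem hy, indicator_of_notMem fun h => hy h.2]

lemma memLp_extend (hT : 0 < T) (hf : LocallyL2 f) :
    MemLp (extend T f) 2 (volume.prod volume) := by
  refine (memLp_indicator_iff_restrict (measurableSet_Ioo.prod measurableSet_Ioo)).2 ?_
  rw [← Measure.prod_restrict]
  exact hf T hT

lemma memLp_extend_mul_id {F : ℝ × ℝ → ℂ} (hF : MemLp F 2 (volume.prod volume))
    (h0 : ∀ z : ℝ × ℝ, z.2 ∉ Ioo (-1 : ℝ) 1 → F z = 0) :
    MemLp (fun z : ℝ × ℝ => (z.2 : ℂ) * F z) 2 (volume.prod volume) := by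
  refine hF.of_le_mul (c := 1)
    ((Complex.continuous_ofReal.comp continuous_snd).aestronglyMeasurable.mul hF.1) ?_
  refine Eventually.of_forall fun z => ?_
  by_cases hm : z.2 ∈ Ioo (-1 : ℝ) 1
  · rw [norm_mul, Complex.norm_real]
    exact mul_le_mul_of_nonneg_right (abs_le.2 ⟨hm.1.le, hm.2.le⟩) (norm_nonneg _)
  · rw [h0 z hm]
    simp

lemma memLp_plane_bulkForce (ν k : ℝ) {G₁ V : ℝ × ℝ → ℂ} (h₁ : MemLp G₁ 2 (volume.prod volume))
    (hV : MemLp V 2 (volume.prod volume))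
    (h0 : ∀ z : ℝ × ℝ, z.2 ∉ Ioo (-1 : ℝ) 1 → V z = 0) :
    MemLp (fun z : ℝ × ℝ => bulkForce ν k (fun y => G₁ (z.1, y)) (fun y => V (z.1, y)) z.2) 2
      (volume.prod volume) :=
  (((h₁.const_mul Complex.I).const_mul (k : ℂ)).neg.sub
    (((memLp_extend_mul_id hV h0).const_mul Complex.I).const_mul (k : ℂ))).sub
    (hV.const_mul ((ν * k ^ 2 : ℝ) : ℂ))

lemma memLp_plane_fluxForce (ν : ℝ) {G₂ W : ℝ × ℝ → ℂ} (h₂ : MemLp G₂ 2 (volume.prod volume))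
    (hW : MemLp W 2 (volume.prod volume)) :
    MemLp (fun z : ℝ × ℝ => fluxForce ν (fun y => G₂ (z.1, y)) (fun y => W (z.1, y)) z.2) 2
      (volume.prod volume) :=
  h₂.sub (hW.const_mul (ν : ℂ))

lemma memLp_plane_shift {V : ℝ × ℝ → ℂ} (hV : MemLp V 2 (volume.prod volume)) (h : ℝ) :
    MemLp (fun z : ℝ × ℝ => V (z.1, z.2 + h)) 2 (volume.prod volume) :=
  hV.comp_measurePreserving
    ((MeasurePreserving.id volume).prod (measurePreserving_add_right volume h))

lemma memLp_plane_bounded_mul {V : ℝ × ℝ → ℂ} (hV : MemLp V 2 (volume.prod volume)) {m : ℝ → ℝ}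
    (hm : Measurable m) {M : ℝ} (hM : ∀ y, |m y| ≤ M) :
    MemLp (fun z : ℝ × ℝ => (m z.2 : ℂ) * V z) 2 (volume.prod volume) := by
  refine hV.of_le_mul (c := M)
    ((Complex.measurable_ofReal.comp (hm.comp measurable_snd)).aestronglyMeasurable.mul hV.1) ?_
  refine Eventually.of_forall fun z => ?_
  rw [norm_mul, Complex.norm_real]
  exact mul_le_mul_of_nonneg_right (hM z.2) (norm_nonneg _)

lemma memLp_plane_twist (c : ℝ) (hδ : 0 < δ) {V : ℝ × ℝ → ℂ}
    (hV : MemLp V 2 (volume.prod volume)) :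
    MemLp (fun z : ℝ × ℝ => twist c δ (fun y => V (z.1, y)) z.2) 2 (volume.prod volume) := by
  have hc : ∀ y, |cutoff δ y| ≤ 1 := fun y =>
    abs_le.2 ⟨by linarith [cutoff_nonneg δ y], cutoff_le_one δ y⟩
  have hm := (continuous_cutoff hδ).measurable
  have h1 := memLp_plane_bounded_mul (memLp_plane_shift hV δ) hm hc
  have h2 := memLp_plane_shift (memLp_plane_bounded_mul hV hm hc) (-δ)
  simp only [← sub_eq_add_neg] at h2
  exact hV.add ((h1.sub h2).const_mul _)

lemma memLp_plane_twistDeriv (c : ℝ) (hδ : 0 < δ) {V W : ℝ × ℝ → ℂ}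
    (hV : MemLp V 2 (volume.prod volume)) (hW : MemLp W 2 (volume.prod volume)) :
    MemLp (fun z : ℝ × ℝ => twistDeriv c δ (fun y => V (z.1, y)) (fun y => W (z.1, y)) z.2) 2
      (volume.prod volume) := by
  have hc : ∀ y, |cutoff δ y| ≤ 1 := fun y =>
    abs_le.2 ⟨by linarith [cutoff_nonneg δ y], cutoff_le_one δ y⟩
  have hm := (continuous_cutoff hδ).measurable
  have hm' := measurable_deriv (cutoff δ)
  have h1 := memLp_plane_bounded_mul (memLp_plane_shift hW δ) hm hc
  have h2 := memLp_plane_shift (memLp_plane_bounded_mul hW hm hc) (-δ)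
  have h3 := memLp_plane_bounded_mul (memLp_plane_shift hV δ) hm' (abs_deriv_cutoff_le hδ)
  have h4 := memLp_plane_shift (memLp_plane_bounded_mul hV hm' (abs_deriv_cutoff_le hδ)) (-δ)
  simp only [← sub_eq_add_neg] at h2 h4
  exact hW.add (((h3.add h1).sub (h4.add h2)).const_mul _)

lemma integrable_mul_slice {F : ℝ × ℝ → ℂ} (hF : MemLp F 2 (volume.prod volume)) {φ : ℝ → ℂ}
    (hφ : MemLp φ 2 volume) (t : ℝ) :
    Integrable (fun z : ℝ × ℝ => F z * φ z.2) ((volume.restrict (Ioc 0 t)).prod volume) := by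
  have h1 : MemLp F 2 ((volume.restrict (Ioc 0 t)).prod volume) :=
    hF.mono_measure (Measure.prod_mono Measure.restrict_le_self le_rfl)
  exact h1.integrable_mul (hφ.comp_snd _)

lemma integral_channel_eq (g φ : ℝ → ℂ) :
    ∫ y, g y * φ y ∂channelMeasure = ∫ y, (Ioo (-1 : ℝ) 1).indicator g y * φ y := by
  rw [← integral_indicator measurableSet_Ioo]
  congr 1
  ext y
  by_cases hy : y ∈ Ioo (-1 : ℝ) 1
  · simp [hy]
  · simp [hy]

lemma re_integral_mul_conj {μ : Measure ℝ} {g ψ : ℝ → ℂ} (hg : MemLp g 2 μ) (hψ : MemLp ψ 2 μ) :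
    (∫ y, g y * starRingEnd ℂ (ψ y) ∂μ).re = ∫ y, inner ℝ (ψ y) (g y) ∂μ := by
  have h : Integrable (fun y => g y * starRingEnd ℂ (ψ y)) μ := hg.integrable_mul hψ.star
  rw [← Complex.reCLM_apply, ← Complex.reCLM.integral_comp_comm h]
  simp only [Complex.inner, Complex.reCLM_apply]

/-- The space integral in the weak formulation at a fixed time, for functions extended by zero. -/
lemma integral_weak_eq (ν k : ℝ) {g₁ g₂ θ θy φ φ' : ℝ → ℂ} (h₁ : MemLp g₁ 2 channelMeasure)
    (h₂ : MemLp g₂ 2 channelMeasure) (hθ : MemLp θ 2 channelMeasure)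
    (hθy : MemLp θy 2 channelMeasure) (hyθ : MemLp (fun y : ℝ => (y : ℂ) * θ y) 2 channelMeasure)
    (hφ : MemLp φ 2 volume) (hφ' : MemLp φ' 2 volume) :
    (∫ y, (-(Complex.I * k * g₁ y) * φ y + g₂ y * φ' y) ∂channelMeasure) -
        ∫ y, (Complex.I * k * y * θ y * φ y
          + ν * (θy y * φ' y + (k : ℂ) ^ 2 * θ y * φ y)) ∂channelMeasure =
      (∫ y, bulkForce ν k ((Ioo (-1 : ℝ) 1).indicator g₁) ((Ioo (-1 : ℝ) 1).indicator θ) y * φ y) +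
        ∫ y, fluxForce ν ((Ioo (-1 : ℝ) 1).indicator g₂) ((Ioo (-1 : ℝ) 1).indicator θy) y
          * φ' y := by
  have e1 : bulkForce ν k ((Ioo (-1 : ℝ) 1).indicator g₁) ((Ioo (-1 : ℝ) 1).indicator θ) =
      (Ioo (-1 : ℝ) 1).indicator (bulkForce ν k g₁ θ) := by
    ext y
    by_cases hy : y ∈ Ioo (-1 : ℝ) 1
    · simp [bulkForce, hy]
    · simp [bulkForce, hy]
  have e2 : fluxForce ν ((Ioo (-1 : ℝ) 1).indicator g₂) ((Ioo (-1 : ℝ) 1).indicator θy) =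
      (Ioo (-1 : ℝ) 1).indicator (fluxForce ν g₂ θy) := by
    ext y
    by_cases hy : y ∈ Ioo (-1 : ℝ) 1
    · simp [fluxForce, hy]
    · simp [fluxForce, hy]
  have hφc : MemLp φ 2 channelMeasure := hφ.restrict _
  have hφc' : MemLp φ' 2 channelMeasure := hφ'.restrict _
  have i1 : Integrable (fun y => -(Complex.I * k * g₁ y) * φ y) channelMeasure :=
    (h₁.const_mul (Complex.I * k)).neg.integrable_mul hφc
  have i2 : Integrable (fun y => g₂ y * φ' y) channelMeasure := h₂.integrable_mul hφc'
  have i3 : Integrable (fun y : ℝ => Complex.I * k * y * θ y * φ y) channelMeasure := by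
    have : Integrable (fun y : ℝ => (Complex.I * k * ((y : ℂ) * θ y)) * φ y) channelMeasure :=
      (hyθ.const_mul (Complex.I * k)).integrable_mul hφc
    simpa only [mul_assoc] using this
  have i4 : Integrable (fun y => θy y * φ' y) channelMeasure := hθy.integrable_mul hφc'
  have i5 : Integrable (fun y => (k : ℂ) ^ 2 * θ y * φ y) channelMeasure :=
    (hθ.const_mul ((k : ℂ) ^ 2)).integrable_mul hφc
  have i6 : Integrable (fun y => bulkForce ν k g₁ θ y * φ y) channelMeasure := by
    refine ((i1.sub i3).sub (i5.const_mul (ν : ℂ))).congr (Eventually.of_forall fun y => ?_)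
    simp only [bulkForce, Pi.sub_apply]
    push_cast
    ring
  have i7 : Integrable (fun y => fluxForce ν g₂ θy y * φ' y) channelMeasure := by
    refine (i2.sub (i4.const_mul (ν : ℂ))).congr (Eventually.of_forall fun y => ?_)
    simp only [fluxForce, Pi.sub_apply]
    ring
  have i8 : Integrable (fun y => -(Complex.I * k * g₁ y) * φ y + g₂ y * φ' y) channelMeasure :=
    i1.add i2
  have i9 : Integrable (fun y : ℝ => Complex.I * k * y * θ y * φ y
      + ν * (θy y * φ' y + (k : ℂ) ^ 2 * θ y * φ y)) channelMeasure :=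
    i3.add ((i4.add i5).const_mul (ν : ℂ))
  rw [e1, e2, ← integral_channel_eq, ← integral_channel_eq, ← integral_sub i8 i9,
    ← integral_add i6 i7]
  congr 1
  ext y
  simp only [bulkForce, fluxForce]
  push_cast
  ring

end

noncomputable section

/-- The squared norm of a function in `L²(-1, 1)`. -/
def normSq (f : ℝ → ℂ) : ℝ := ∫ y, ‖f y‖ ^ 2 ∂channelMeasure

lemma integral_norm_indicator_sq (f : ℝ → ℂ) :
    ∫ y, ‖(Ioo (-1 : ℝ) 1).indicator f y‖ ^ 2 = normSq f := by
  rw [normSq, ← integral_indicator measurableSet_Ioo]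
  congr 1
  ext y
  by_cases hy : y ∈ Ioo (-1 : ℝ) 1
  · simp [hy]
  · simp [hy]

lemma integral_norm_extend_sq {T t : ℝ} (ht : t ∈ Ioo 0 T) {f : ℝ → ℝ → ℂ} :
    ∫ y, ‖extend T f (t, y)‖ ^ 2 = normSq (f t) := by
  rw [← integral_norm_indicator_sq, ← extend_slice ht]

lemma memLp_indicator_channel {f : ℝ → ℂ} :
    MemLp ((Ioo (-1 : ℝ) 1).indicator f) 2 volume ↔ MemLp f 2 channelMeasure :=
  memLp_indicator_iff_restrict measurableSet_Ioo

lemma ae_memLp_of_locallyL2 {T : ℝ} (hT : 0 < T) {f : ℝ → ℝ → ℂ} (hf : LocallyL2 f) :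
    ∀ᵐ t : ℝ, t ∈ Ioo 0 T → MemLp (f t) 2 channelMeasure := by
  filter_upwards [ae_memLp_slice (memLp_extend hT hf)] with t h ht
  rw [extend_slice ht] at h
  exact memLp_indicator_channel.1 h

lemma integrableOn_normSq {T : ℝ} (hT : 0 < T) {f : ℝ → ℝ → ℂ} (hf : LocallyL2 f) :
    IntegrableOn (fun t => normSq (f t)) (Ioo 0 T) := by
  have h : Integrable (fun t => ∫ y, ‖extend T f (t, y)‖ ^ 2) :=
    (integrable_norm_sq (memLp_extend hT hf)).integral_prod_left
  refine h.integrableOn.congr_fun (fun t ht => ?_) measurableSet_Ioo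
  exact integral_norm_extend_sq ht

lemma memLp_channel_mul_id {f : ℝ → ℂ} (hf : MemLp f 2 channelMeasure) :
    MemLp (fun y : ℝ => (y : ℂ) * f y) 2 channelMeasure := by
  refine hf.of_le_mul (c := 1) (Complex.continuous_ofReal.aestronglyMeasurable.mul hf.1) ?_
  filter_upwards [ae_restrict_mem measurableSet_Ioo] with y hm
  rw [norm_mul, Complex.norm_real]
  exact mul_le_mul_of_nonneg_right (abs_le.2 ⟨hm.1.le, hm.2.le⟩) (norm_nonneg _)

/-- A differential bound for the twisted energy, valid for all functions that vanish at the walls,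
integrates to an energy estimate for weak solutions. -/
theorem IsWeakSolution.energy_estimate {ν k c δ m A B T : ℝ} {g₁ g₂ θ : ℝ → ℝ → ℂ} {θin : ℝ → ℂ}
    (hθw : IsWeakSolution ν k g₁ g₂ θin θ) (h₁ : LocallyL2 g₁) (h₂ : LocallyL2 g₂)
    (hin : MemLp θin 2 channelMeasure) (hδ : 0 < δ) (hc : |c| ≤ 1 / 30) (hT : 0 < T)
    (hrate : ∀ G₁ G₂ v w : ℝ → ℂ, IsZeroExtH10 v w → MemLp G₁ 2 volume → MemLp G₂ 2 volume →
      energyRate ν k c δ G₁ G₂ v w ≤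
        -(m * ∫ y, ‖v y‖ ^ 2) + A * (∫ y, ‖G₁ y‖ ^ 2) + B * ∫ y, ‖G₂ y‖ ^ 2) :
    ∀ᵐ b : ℝ, b ∈ Ioo 0 T →
      1 / 2 * normSq (θ b) + 2 * m * (∫ t in Ioc 0 b, normSq (θ t)) ≤
        6 * normSq θin + 2 * A * (∫ t in Ioc 0 b, normSq (g₁ t)) +
          2 * B * ∫ t in Ioc 0 b, normSq (g₂ t) := by
  obtain ⟨hθ, θy, hθy, hH10, hweak⟩ := hθw
  have hV := memLp_extend hT hθ
  have hW := memLp_extend hT hθy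
  have hG₁ := memLp_extend hT h₁
  have hG₂ := memLp_extend hT h₂
  set V := extend T θ with hVdef
  set W := extend T θy with hWdef
  set G₁ := extend T g₁ with hG₁def
  set G₂ := extend T g₂ with hG₂def
  have hV0 : ∀ z : ℝ × ℝ, z.2 ∉ Ioo (-1 : ℝ) 1 → V z = 0 := fun z hz =>
    indicator_of_notMem (fun h => hz h.2) _
  have hf₀ := memLp_plane_bulkForce ν k hG₁ hV hV0
  have hf₁ := memLp_plane_fluxForce ν hG₂ hW
  have hψ := memLp_plane_twist c hδ hV
  have hψ' := memLp_plane_twistDeriv c hδ hV hW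
  set p : ℝ → ℝ → ℝ := fun s t =>
    (∫ y, inner ℝ (twist c δ (fun y => V (t, y)) y)
      (bulkForce ν k (fun y => G₁ (s, y)) (fun y => V (s, y)) y)) +
    ∫ y, inner ℝ (twistDeriv c δ (fun y => V (t, y)) (fun y => W (t, y)) y)
      (fluxForce ν (fun y => G₂ (s, y)) (fun y => W (s, y)) y) with hpdef
  have hp : IsCorrelation p :=
    (isCorrelation_integral_inner hf₀ hψ).add (isCorrelation_integral_inner hf₁ hψ')
  set a : ℝ → ℝ → ℝ := fun t r => ∫ y, inner ℝ (twist c δ (fun y => V (r, y)) y) (V (t, y))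
    with hadef
  have he : Integrable fun t => a t t := (memLp_inner hψ hV).integral_prod_left
  set θ₀ := (Ioo (-1 : ℝ) 1).indicator θin with hθ₀
  have hθ₀m : MemLp θ₀ 2 volume := memLp_indicator_channel.2 hin
  set I : ℝ → ℝ := fun r => ∫ y, inner ℝ (twist c δ (fun y => V (r, y)) y) (θ₀ y) with hIdef
  set good : ℝ → Prop := fun t => t ∈ Ioo 0 T ∧ IsH10 (θ t) (θy t) ∧
    ∀ φ φ' : ℝ → ℂ, IsH10 φ φ' → ∫ y, θ t y * φ y ∂channelMeasure =
        (∫ y, θin y * φ y ∂channelMeasure) +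
        ∫ s in (0 : ℝ)..t,
          ((∫ y, (-(Complex.I * k * g₁ s y) * φ y + g₂ s y * φ' y) ∂channelMeasure) -
            ∫ y, (Complex.I * k * y * θ s y * φ y
              + ν * (θy s y * φ' y + (k : ℂ) ^ 2 * θ s y * φ y)) ∂channelMeasure) with hgooddef
  have hgood : ∀ᵐ t : ℝ, t ∈ Ioo 0 T → good t := by
    filter_upwards [(ae_restrict_iff' measurableSet_Ioi).1 hH10,
      (ae_restrict_iff' measurableSet_Ioi).1 hweak] with t g1 g2 ht
    exact ⟨ht, g1 ht.1, g2 ht.1⟩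
  have hext : ∀ t, good t → IsZeroExtH10 (fun y => V (t, y)) (fun y => W (t, y)) := fun t ht => by
    rw [hVdef, hWdef, extend_slice ht.1, extend_slice ht.1]
    exact ht.2.1.isZeroExtH10
  have hsymm : ∀ t r, good t → good r → a t r = a r t := fun t r ht hr =>
    integral_inner_twist_comm c hδ (hext r hr).memLp (hext t ht).memLp
  have hw : ∀ t r, good t → good r → a t r = I r + ∫ s in (0 : ℝ)..t, p s r := by
    intro t r ht hr
    have hvr := hext r hr
    have hS := memLp_twist c hδ hvr.memLp
    have hS' := memLp_twistDeriv c hδ hvr.memLp hvr.memLp_deriv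
    set φ : ℝ → ℂ := fun y => starRingEnd ℂ (twist c δ (fun y => V (r, y)) y) with hφ
    set φ' : ℝ → ℂ := fun y =>
      starRingEnd ℂ (twistDeriv c δ (fun y => V (r, y)) (fun y => W (r, y)) y) with hφ'
    have hφm : MemLp φ 2 volume := hS.star
    have hφm' : MemLp φ' 2 volume := hS'.star
    have key := congrArg Complex.re (ht.2.2 φ φ' (hvr.isH10_conj_twist c hδ))
    have l1 : (∫ y, θ t y * φ y ∂channelMeasure).re = a t r := by
      rw [integral_channel_eq, ← extend_slice ht.1]
      exact re_integral_mul_conj (hext t ht).memLp hS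
    have l2 : (∫ y, θin y * φ y ∂channelMeasure).re = I r := by
      rw [integral_channel_eq]
      exact re_integral_mul_conj hθ₀m hS
    set L : ℝ → ℂ := fun s =>
      (∫ y, bulkForce ν k (fun y => G₁ (s, y)) (fun y => V (s, y)) y * φ y) +
        ∫ y, fluxForce ν (fun y => G₂ (s, y)) (fun y => W (s, y)) y * φ' y with hL
    have hLi : Integrable L (volume.restrict (Ioc 0 t)) :=
      (integrable_mul_slice hf₀ hφm t).integral_prod_left.add
        (integrable_mul_slice hf₁ hφm' t).integral_prod_left
    have l3 : ∫ s in (0 : ℝ)..t,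
          ((∫ y, (-(Complex.I * k * g₁ s y) * φ y + g₂ s y * φ' y) ∂channelMeasure) -
            ∫ y, (Complex.I * k * y * θ s y * φ y
              + ν * (θy s y * φ' y + (k : ℂ) ^ 2 * θ s y * φ y)) ∂channelMeasure) =
        ∫ s in (0 : ℝ)..t, L s := by
      refine intervalIntegral.integral_congr_ae ?_
      filter_upwards [ae_memLp_of_locallyL2 hT h₁, ae_memLp_of_locallyL2 hT h₂,
        ae_memLp_of_locallyL2 hT hθ, ae_memLp_of_locallyL2 hT hθy] with s m1 m2 m3 m4 hs
      rw [uIoc_of_le ht.1.1.le] at hs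
      have hsT : s ∈ Ioo 0 T := ⟨hs.1, hs.2.trans_lt ht.1.2⟩
      rw [integral_weak_eq ν k (m1 hsT) (m2 hsT) (m3 hsT) (m4 hsT)
        (memLp_channel_mul_id (m3 hsT)) hφm hφm']
      simp only [hL, hG₁def, hG₂def, hVdef, hWdef, extend_slice hsT]
    have l4 : (∫ s in (0 : ℝ)..t, L s).re = ∫ s in (0 : ℝ)..t, p s r := by
      rw [intervalIntegral.integral_of_le ht.1.1.le, intervalIntegral.integral_of_le ht.1.1.le,
        ← Complex.reCLM_apply, ← Complex.reCLM.integral_comp_comm hLi]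
      refine integral_congr_ae (ae_restrict_of_ae ?_)
      filter_upwards [ae_memLp_slice hf₀, ae_memLp_slice hf₁] with s m1 m2
      simp only [Complex.reCLM_apply, hL, Complex.add_re, hpdef]
      rw [← re_integral_mul_conj m1 hS, ← re_integral_mul_conj m2 hS']
    rw [l3, Complex.add_re, l1, l2, l4] at key
    exact key
  have hI : ∀ t, good t → I t ≤ 6 * normSq θin / 2 + a t t / 2 := by
    intro t ht
    have hm := (hext t ht).memLp
    have b1 := (abs_le.1 (abs_integral_inner_le (memLp_twist c hδ hm) hθ₀m (a := 1 / 12) (b := 3)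
      (by norm_num) (by norm_num) (by norm_num))).2
    have b2 := integral_norm_twist_sq_le hc hδ hm
    have b3 := half_le_integral_inner_twist hc hδ hm
    rw [hθ₀, integral_norm_indicator_sq] at b1
    simp only [hIdef, hadef]
    linarith
  filter_upwards [energy_le_of_weak hp he hgood hsymm hw hI, hgood] with b hb hgb hbT
  have e1 := hb hbT
  have e2 := half_le_integral_inner_twist hc hδ (hext b (hgb hbT)).memLp
  have hsub : Ioc 0 b ⊆ Ioo 0 T := fun t ht => ⟨ht.1, ht.2.trans_lt hbT.2⟩
  have j0 := (integrableOn_normSq hT hθ).mono_set hsub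
  have j1 := (integrableOn_normSq hT h₁).mono_set hsub
  have j2 := (integrableOn_normSq hT h₂).mono_set hsub
  have i01 : IntegrableOn (fun t => -(m * normSq (θ t)) + A * normSq (g₁ t)) (Ioc 0 b) :=
    (j0.const_mul m).neg.add (j1.const_mul A)
  have i0 : IntegrableOn (fun t => -(m * normSq (θ t))) (Ioc 0 b) := (j0.const_mul m).neg
  have e3 : ∫ t in Ioc 0 b, p t t ≤
      ∫ t in Ioc 0 b, (-(m * normSq (θ t)) + A * normSq (g₁ t) + B * normSq (g₂ t)) := by
    refine setIntegral_mono_ae_restrict hp.integrable_diag.integrableOn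
      (i01.add (j2.const_mul B)) ?_
    refine (ae_restrict_iff' measurableSet_Ioc).2 ?_
    filter_upwards [hgood, ae_memLp_slice hG₁, ae_memLp_slice hG₂] with t gt m1 m2 ht
    have htT := hsub ht
    have h := hrate _ _ _ _ (hext t (gt htT)) m1 m2
    simp only [hG₁def, hG₂def, hVdef] at h
    rw [integral_norm_extend_sq htT, integral_norm_extend_sq htT,
      integral_norm_extend_sq htT] at h
    exact h
  rw [integral_add i01 (j2.const_mul B), integral_add i0 (j1.const_mul A), integral_neg,
    integral_const_mul, integral_const_mul, integral_const_mul] at e3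
  have e4 : ∫ y, ‖V (b, y)‖ ^ 2 = normSq (θ b) := by
    rw [hVdef, integral_norm_extend_sq hbT]
  rw [e4] at e2
  simp only [hadef] at e1
  linarith

end

noncomputable section

/-! ### Mixed norms -/

lemma ofReal_normSq {f : ℝ → ℂ} (hf : MemLp f 2 channelMeasure) :
    ENNReal.ofReal (normSq f) = eLpNorm f 2 channelMeasure ^ 2 := by
  have h := eLpNorm_nnreal_pow_eq_lintegral (f := f) (μ := channelMeasure) (p := 2) two_ne_zero
  simp only [NNReal.coe_ofNat, ENNReal.coe_ofNat, ENNReal.rpow_ofNat] at h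
  rw [h, normSq, ofReal_integral_eq_lintegral_ofReal (integrable_norm_sq hf)
    (Eventually.of_forall fun _ => by positivity)]
  refine lintegral_congr fun y => ?_
  rw [ENNReal.ofReal_pow (norm_nonneg _), ofReal_norm]

lemma mixedNorm_two_sq (f : ℝ → ℝ → ℂ) :
    mixedNorm 2 f ^ 2 = ∫⁻ t in Ioi (0 : ℝ), eLpNorm (f t) 2 channelMeasure ^ 2 := by
  have h := eLpNorm_nnreal_pow_eq_lintegral (f := fun t => eLpNorm (f t) 2 channelMeasure)
    (μ := timeMeasure) (p := 2) two_ne_zero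
  simp only [NNReal.coe_ofNat, ENNReal.coe_ofNat, ENNReal.rpow_ofNat, enorm_eq_self] at h
  exact h

lemma normSq_nonneg (f : ℝ → ℂ) : 0 ≤ normSq f := integral_norm_sq_nonneg _ f

lemma ofReal_integral_normSq {T b : ℝ} (hb : b ∈ Ioo 0 T) {f : ℝ → ℝ → ℂ} (hf : LocallyL2 f) :
    ENNReal.ofReal (∫ t in Ioc 0 b, normSq (f t)) =
      ∫⁻ t in Ioc 0 b, eLpNorm (f t) 2 channelMeasure ^ 2 := by
  have hT : 0 < T := hb.1.trans hb.2
  have hsub : Ioc 0 b ⊆ Ioo 0 T := fun t ht => ⟨ht.1, ht.2.trans_lt hb.2⟩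
  rw [ofReal_integral_eq_lintegral_ofReal ((integrableOn_normSq hT hf).mono_set hsub)
    (Eventually.of_forall fun _ => normSq_nonneg _)]
  refine setLIntegral_congr_fun_ae measurableSet_Ioc ?_
  filter_upwards [ae_memLp_of_locallyL2 hT hf] with t h ht
  exact ofReal_normSq (h (hsub ht))

lemma lintegral_Ioc_le_mixedNorm_sq (b : ℝ) (f : ℝ → ℝ → ℂ) :
    ∫⁻ t in Ioc 0 b, eLpNorm (f t) 2 channelMeasure ^ 2 ≤ mixedNorm 2 f ^ 2 := by
  rw [mixedNorm_two_sq]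
  exact lintegral_mono_set Ioc_subset_Ioi_self

lemma mixedNorm_two_sq_eq_iSup (f : ℝ → ℝ → ℂ) :
    mixedNorm 2 f ^ 2 = ⨆ n : ℕ, ∫⁻ t in Ioc (0 : ℝ) n, eLpNorm (f t) 2 channelMeasure ^ 2 := by
  have hU : ⋃ n : ℕ, Ioc (0 : ℝ) n = Ioi 0 := iUnion_Ioc_eq_Ioi_self_iff.2 fun x _ =>
    exists_nat_ge x
  rw [mixedNorm_two_sq, ← hU, setLIntegral_iUnion_of_directed]
  exact Monotone.directed_le fun i j hij => Ioc_subset_Ioc_right (by exact_mod_cast hij)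

/-- From the estimate at almost every time `b`, whose right-hand side is bounded independently
of `b`, to the mixed norms over the whole half-line. -/
lemma mixedNorm_le_of_energy_estimate {m A B r c₁ c₂ : ℝ} {g₁ g₂ θ : ℝ → ℝ → ℂ} {θin : ℝ → ℂ}
    (hθ : LocallyL2 θ) (h₁ : LocallyL2 g₁) (h₂ : LocallyL2 g₂) (hin : MemLp θin 2 channelMeasure)
    (hm : 0 < m) (hr : 0 ≤ r) (hc₁ : 0 ≤ c₁) (hc₂ : 0 ≤ c₂)
    (hA' : A ≤ 160 * c₁ ^ 2) (hB' : B ≤ 3 * c₂ ^ 2) (hr' : r ^ 2 ≤ 100 * m)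
    (hest : ∀ T : ℝ, 0 < T → ∀ᵐ b : ℝ, b ∈ Ioo 0 T →
      1 / 2 * normSq (θ b) + 2 * m * (∫ t in Ioc 0 b, normSq (θ t)) ≤
        6 * normSq θin + 2 * A * (∫ t in Ioc 0 b, normSq (g₁ t)) +
          2 * B * ∫ t in Ioc 0 b, normSq (g₂ t)) :
    mixedNorm ⊤ θ + ENNReal.ofReal r * mixedNorm 2 θ ≤
      ENNReal.ofReal 200 * eLpNorm θin 2 channelMeasure + ENNReal.ofReal 200 *
        (ENNReal.ofReal c₁ * mixedNorm 2 g₁ + ENNReal.ofReal c₂ * mixedNorm 2 g₂) := by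
  set S := eLpNorm θin 2 channelMeasure +
    (ENNReal.ofReal c₁ * mixedNorm 2 g₁ + ENNReal.ofReal c₂ * mixedNorm 2 g₂) with hS
  have hbound : ∀ T : ℝ, 0 < T → ∀ᵐ b : ℝ, b ∈ Ioo 0 T →
      eLpNorm (θ b) 2 channelMeasure ^ 2 ≤ 640 * S ^ 2 ∧
      ENNReal.ofReal (2 * m) * ∫⁻ t in Ioc 0 b, eLpNorm (θ t) 2 channelMeasure ^ 2 ≤
        320 * S ^ 2 := by
    intro T hT
    filter_upwards [hest T hT, ae_memLp_of_locallyL2 hT hθ] with b h hmem hb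
    have hb' := h hb
    have i0 : 0 ≤ ∫ t in Ioc 0 b, normSq (θ t) := integral_nonneg fun _ => normSq_nonneg _
    have i1 : 0 ≤ ∫ t in Ioc 0 b, normSq (g₁ t) := integral_nonneg fun _ => normSq_nonneg _
    have i2 : 0 ≤ ∫ t in Ioc 0 b, normSq (g₂ t) := integral_nonneg fun _ => normSq_nonneg _
    have n0 := normSq_nonneg (θ b)
    have n1 := normSq_nonneg θin
    have hR : ENNReal.ofReal (6 * normSq θin + 2 * A * (∫ t in Ioc 0 b, normSq (g₁ t)) +
        2 * B * ∫ t in Ioc 0 b, normSq (g₂ t)) ≤ 320 * S ^ 2 := by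
      have hle : 6 * normSq θin + 2 * A * (∫ t in Ioc 0 b, normSq (g₁ t)) +
          2 * B * (∫ t in Ioc 0 b, normSq (g₂ t)) ≤
          320 * (normSq θin + (c₁ ^ 2 * (∫ t in Ioc 0 b, normSq (g₁ t)) +
            c₂ ^ 2 * ∫ t in Ioc 0 b, normSq (g₂ t))) := by
        have q1 := mul_le_mul_of_nonneg_right hA' i1
        have q2 := mul_le_mul_of_nonneg_right hB' i2
        have q3 : 0 ≤ c₂ ^ 2 * ∫ t in Ioc 0 b, normSq (g₂ t) := by positivity
        linarith
      refine (ENNReal.ofReal_le_ofReal hle).trans ?_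
      rw [ENNReal.ofReal_mul (by norm_num), ENNReal.ofReal_add n1 (by positivity),
        ENNReal.ofReal_add (by positivity) (by positivity), ENNReal.ofReal_mul (by positivity),
        ENNReal.ofReal_mul (by positivity), ENNReal.ofReal_pow hc₁, ENNReal.ofReal_pow hc₂,
        ofReal_normSq hin, ofReal_integral_normSq hb h₁, ofReal_integral_normSq hb h₂,
        ENNReal.ofReal_ofNat]
      refine mul_le_mul_right ?_ _
      calc _ ≤ eLpNorm θin 2 channelMeasure ^ 2 + ((ENNReal.ofReal c₁ * mixedNorm 2 g₁) ^ 2 +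
            (ENNReal.ofReal c₂ * mixedNorm 2 g₂) ^ 2) := by
            rw [mul_pow, mul_pow]
            gcongr
            · exact lintegral_Ioc_le_mixedNorm_sq b g₁
            · exact lintegral_Ioc_le_mixedNorm_sq b g₂
        _ ≤ S ^ 2 := by
            rw [hS]
            generalize eLpNorm θin 2 channelMeasure = x
            generalize ENNReal.ofReal c₁ * mixedNorm 2 g₁ = y
            generalize ENNReal.ofReal c₂ * mixedNorm 2 g₂ = z
            have : (x + (y + z)) ^ 2 = x ^ 2 + (y ^ 2 + z ^ 2) + 2 * (x * y + x * z + y * z) := by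
              ring
            rw [this]
            exact le_self_add
    constructor
    · have h3 : normSq (θ b) ≤ 2 * (6 * normSq θin + 2 * A * (∫ t in Ioc 0 b, normSq (g₁ t)) +
          2 * B * ∫ t in Ioc 0 b, normSq (g₂ t)) := by
        have : 0 ≤ 2 * m * ∫ t in Ioc 0 b, normSq (θ t) := by positivity
        linarith
      rw [← ofReal_normSq (hmem hb)]
      refine (ENNReal.ofReal_le_ofReal h3).trans ?_
      rw [ENNReal.ofReal_mul (by norm_num), ENNReal.ofReal_ofNat]
      calc _ ≤ 2 * (320 * S ^ 2) := mul_le_mul_right hR 2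
        _ = 640 * S ^ 2 := by
            rw [← mul_assoc]
            norm_num
    · rw [← ofReal_integral_normSq hb hθ, ← ENNReal.ofReal_mul (by positivity)]
      exact (ENNReal.ofReal_le_ofReal (by linarith)).trans hR
  -- `640 ≤ 26 ^ 2`
  have hsup : mixedNorm ⊤ θ ≤ 26 * S := by
    rw [mixedNorm, eLpNorm_exponent_top]
    refine essSup_le_of_ae_le _ ((ae_restrict_iff' measurableSet_Ioi).2 ?_)
    have hall : ∀ᵐ b : ℝ, ∀ n : ℕ, b ∈ Ioo 0 ((n : ℝ) + 1) →
        eLpNorm (θ b) 2 channelMeasure ^ 2 ≤ 640 * S ^ 2 := by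
      refine ae_all_iff.2 fun n => ?_
      filter_upwards [hbound (n + 1) (by positivity)] with b h hb
      exact (h hb).1
    filter_upwards [hall] with b h hb
    obtain ⟨n, hn⟩ := exists_nat_gt b
    rw [enorm_eq_self]
    have h2 := h n ⟨hb, by linarith⟩
    refine (ENNReal.pow_le_pow_left_iff two_ne_zero).1 (h2.trans ?_)
    rw [mul_pow]
    exact mul_le_mul_left (by norm_num) _
  have hL2 : ENNReal.ofReal (2 * m) * mixedNorm 2 θ ^ 2 ≤ 320 * S ^ 2 := by
    rw [mixedNorm_two_sq_eq_iSup, ENNReal.mul_iSup]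
    refine iSup_le fun n => ?_
    have hae := hbound (n + 2) (by positivity)
    have hne : (ae (volume.restrict (Ioo ((n : ℝ)) (n + 1)))).NeBot := by
      rw [ae_restrict_neBot]
      simp
    obtain ⟨b, hb1, hb2⟩ := ((ae_restrict_of_ae hae).and
      (ae_restrict_mem (measurableSet_Ioo (a := (n : ℝ)) (b := n + 1)))).exists
    have hn : (0 : ℝ) ≤ n := n.cast_nonneg
    refine le_trans (mul_le_mul_right (lintegral_mono_set ?_) _)
      (hb1 ⟨by linarith [hb2.1], by linarith [hb2.2]⟩).2
    exact Ioc_subset_Ioc_right hb2.1.le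
  -- `16000 ≤ 127 ^ 2`
  have hL2' : ENNReal.ofReal r * mixedNorm 2 θ ≤ 127 * S := by
    refine (ENNReal.pow_le_pow_left_iff two_ne_zero).1 ?_
    calc (ENNReal.ofReal r * mixedNorm 2 θ) ^ 2 = ENNReal.ofReal (r ^ 2) * mixedNorm 2 θ ^ 2 := by
          rw [mul_pow, ENNReal.ofReal_pow hr]
      _ ≤ ENNReal.ofReal (50 * (2 * m)) * mixedNorm 2 θ ^ 2 :=
          mul_le_mul_left (ENNReal.ofReal_le_ofReal (by linarith)) _
      _ = 50 * (ENNReal.ofReal (2 * m) * mixedNorm 2 θ ^ 2) := by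
          rw [ENNReal.ofReal_mul (by norm_num), ENNReal.ofReal_ofNat, mul_assoc]
      _ ≤ 50 * (320 * S ^ 2) := mul_le_mul_right hL2 _
      _ = 16000 * S ^ 2 := by
          rw [← mul_assoc]
          norm_num
      _ ≤ (127 * S) ^ 2 := by
          rw [mul_pow]
          exact mul_le_mul_left (by norm_num) _
  rw [← mul_add, ← hS, ENNReal.ofReal_ofNat]
  calc _ ≤ 26 * S + 127 * S := add_le_add hsup hL2'
    _ = 153 * S := by
        rw [← add_mul]
        norm_num
    _ ≤ 200 * S := mul_le_mul_left (by norm_num) _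

end

end CouetteTemperature

open CouetteTemperature in
theorem lemma2p5 :
    ∃ C : ℝ, 0 < C ∧
      ∀ (ν k : ℝ), 0 < ν →
      ∀ (g₁ g₂ : ℝ → ℝ → ℂ) (θin : ℝ → ℂ) (θ : ℝ → ℝ → ℂ),
        CouetteTemperature.LocallyL2 g₁ →
        CouetteTemperature.LocallyL2 g₂ →
        MemLp θin 2 CouetteTemperature.channelMeasure →
        CouetteTemperature.IsWeakSolution ν k g₁ g₂ θin θ →
        (10 * ν ≤ |k| →
          CouetteTemperature.mixedNorm ⊤ θ
              + ENNReal.ofReal ((ν * k ^ 2) ^ (1 / 6 : ℝ)) * CouetteTemperature.mixedNorm 2 θ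
            ≤ ENNReal.ofReal C * eLpNorm θin 2 CouetteTemperature.channelMeasure
              + ENNReal.ofReal C *
                (ENNReal.ofReal (ν ^ (-(1 / 6) : ℝ) * |k| ^ (2 / 3 : ℝ))
                    * CouetteTemperature.mixedNorm 2 g₁
                  + ENNReal.ofReal (ν ^ (-(1 / 2) : ℝ)) * CouetteTemperature.mixedNorm 2 g₂)) ∧
        (|k| ≤ 10 * ν →
          CouetteTemperature.mixedNorm ⊤ θ
              + ENNReal.ofReal (ν ^ (1 / 2 : ℝ)) * CouetteTemperature.mixedNorm 2 θ
            ≤ ENNReal.ofReal C * eLpNorm θin 2 CouetteTemperature.channelMeasure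
              + ENNReal.ofReal C *
                (ENNReal.ofReal (ν ^ (-(1 / 6) : ℝ) * |k| ^ (2 / 3 : ℝ))
                    * CouetteTemperature.mixedNorm 2 g₁
                  + ENNReal.ofReal (ν ^ (-(1 / 2) : ℝ)) * CouetteTemperature.mixedNorm 2 g₂)) := by
  refine ⟨200, by norm_num, fun ν k hν g₁ g₂ θin θ h₁ h₂ hin hθ => ?_⟩
  have hν' : ν ≠ 0 := hν.ne'
  have hc₁ : (ν ^ (-(1 / 6) : ℝ) * |k| ^ (2 / 3 : ℝ)) ^ 2 =
      ν ^ (-(1 / 3) : ℝ) * |k| ^ (4 / 3 : ℝ) := by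
    rw [mul_pow, ← Real.rpow_mul_natCast hν.le, ← Real.rpow_mul_natCast (abs_nonneg k)]
    norm_num
  have hc₂ : (ν ^ (-(1 / 2) : ℝ)) ^ 2 = ν⁻¹ := by
    rw [← Real.rpow_mul_natCast hν.le, ← Real.rpow_neg_one]
    norm_num
  have hB' : 3 / ν ≤ 3 * (ν ^ (-(1 / 2) : ℝ)) ^ 2 := by
    rw [hc₂, div_eq_mul_inv]
  refine ⟨fun hk => ?_, fun hk => ?_⟩
  · have hkpos : 0 < |k| := by linarith
    set δ := (ν / |k|) ^ (1 / 3 : ℝ) with hδdef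
    have hδ : 0 < δ := by positivity
    have hδ3 : δ ^ 3 = ν / |k| := by
      rw [hδdef, ← Real.rpow_mul_natCast (by positivity)]
      norm_num
    have hscale : ν = |k| * δ ^ 3 := by
      rw [hδ3]
      field_simp
    -- The sign of the twist makes the commutator with transport dissipative.
    set c : ℝ := if 0 ≤ k then -(1 / 30) else 1 / 30 with hc
    have hck : c * k = -(1 / 30 * |k|) := by
      rw [hc]
      split_ifs with h0
      · rw [abs_of_nonneg h0]
        ring
      · rw [abs_of_neg (not_le.1 h0)]
        ring
    have hcabs : |c| ≤ 1 / 30 := by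
      rw [hc]
      split_ifs <;> norm_num [abs_le]
    refine mixedNorm_le_of_energy_estimate (m := |k| * δ / 100) (A := 150 * (|k| / δ)) (B := 3 / ν)
      hθ.1 h₁ h₂ hin (by positivity) (by positivity) (by positivity) (by positivity) ?_ hB' ?_
      fun T hT => ?_
    · -- The weight of `g₁` is `k² / (|k| δ) = |k| / δ`, the square of the one in the statement.
      have h3 : |k| / δ = ν ^ (-(1 / 3) : ℝ) * |k| ^ (4 / 3 : ℝ) := by
        rw [hδdef, Real.div_rpow hν.le hkpos.le, Real.rpow_neg hν.le,
          show (4 / 3 : ℝ) = 1 + 1 / 3 by norm_num, Real.rpow_add hkpos, Real.rpow_one]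
        field_simp
      rw [hc₁, ← h3]
      have : 0 < |k| / δ := by positivity
      linarith
    · have h4 : ((ν * k ^ 2) ^ (1 / 6 : ℝ)) ^ 2 = |k| * δ := by
        have h5 : ν * k ^ 2 = (|k| * δ) ^ 3 := by
          rw [mul_pow, hδ3, ← sq_abs]
          field_simp
        rw [h5, ← Real.rpow_mul_natCast (by positivity), ← Real.rpow_natCast_mul (by positivity)]
        norm_num
      rw [h4]
      linarith
    · exact hθ.energy_estimate h₁ h₂ hin hδ hcabs hT fun G₁ G₂ v w hv m₁ m₂ =>
        hv.energyRate_le_of_shear hν hδ hscale hck hcabs m₁ m₂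
  · refine mixedNorm_le_of_energy_estimate (m := ν / 8) (A := 16 * (k ^ 2 / ν)) (B := 3 / ν)
      hθ.1 h₁ h₂ hin (by positivity) (by positivity) (by positivity) (by positivity) ?_ hB' ?_
      fun T hT => ?_
    · -- Here the weight of `g₁` is `k² / ν`, which exceeds the one in the statement by a factor
      -- `(|k| / ν)^{2/3} ≤ 10^{2/3}`.
      have h3 : k ^ 2 / ν ≤ 10 * (ν ^ (-(1 / 3) : ℝ) * |k| ^ (4 / 3 : ℝ)) := by
        have e1 : k ^ 2 = |k| ^ (4 / 3 : ℝ) * |k| ^ (2 / 3 : ℝ) := by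
          rw [← Real.rpow_add_of_nonneg (abs_nonneg k) (by norm_num) (by norm_num), ← sq_abs,
            ← Real.rpow_natCast]
          norm_num
        have e2 : |k| ^ (2 / 3 : ℝ) ≤ 10 * ν ^ (2 / 3 : ℝ) := by
          calc |k| ^ (2 / 3 : ℝ) ≤ (10 * ν) ^ (2 / 3 : ℝ) :=
                Real.rpow_le_rpow (abs_nonneg k) hk (by norm_num)
            _ = 10 ^ (2 / 3 : ℝ) * ν ^ (2 / 3 : ℝ) := Real.mul_rpow (by norm_num) hν.le
            _ ≤ 10 * ν ^ (2 / 3 : ℝ) := by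
                refine mul_le_mul_of_nonneg_right ?_ (by positivity)
                calc (10 : ℝ) ^ (2 / 3 : ℝ) ≤ 10 ^ (1 : ℝ) :=
                      Real.rpow_le_rpow_of_exponent_le (by norm_num) (by norm_num)
                  _ = 10 := Real.rpow_one _
        have e3 : ν ^ (-(1 / 3) : ℝ) * ν = ν ^ (2 / 3 : ℝ) := by
          rw [← Real.rpow_add_one hν']
          norm_num
        rw [div_le_iff₀ hν, e1]
        calc |k| ^ (4 / 3 : ℝ) * |k| ^ (2 / 3 : ℝ) ≤ |k| ^ (4 / 3 : ℝ) * (10 * ν ^ (2 / 3 : ℝ)) :=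
              mul_le_mul_of_nonneg_left e2 (by positivity)
          _ = 10 * (ν ^ (-(1 / 3) : ℝ) * |k| ^ (4 / 3 : ℝ)) * ν := by
              rw [← e3]
              ring
      rw [hc₁]
      linarith
    · have h4 : (ν ^ (1 / 2 : ℝ)) ^ 2 = ν := by
        rw [← Real.rpow_mul_natCast hν.le]
        norm_num
      rw [h4]
      linarith
    · exact hθ.energy_estimate h₁ h₂ hin (by norm_num) (by norm_num) hT fun G₁ G₂ v w hv m₁ m₂ =>
        hv.energyRate_le_of_viscous hν m₁ m₂
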